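/- Let $0<\alpha<1$ and $m>0$, and put $A=1-\alpha-\frac{\alpha}{2+m}$, $B=\frac{\alpha}{2+m}$. For $\tau\le z\le 0$ let $$K(z,\tau)=\int_{(z/\tau)^{(2+m)/\alpha}}^{1}\Big((A+B)\big(z-\tau\sigma^{\frac{\alpha}{2+m}}\big)-B\,\tau\sigma^{\frac{\alpha}{2+m}}\Big)(1-\sigma)^{-\alpha}\,d\sigma .$$ For $z_0>0$, a \emph{nontrivial solution with half-width $z_0$} is a continuous function $U:[-z_0,0]\to[0,\infty)$ with $$U(z)=\Big(\frac{m+1}{\Gamma(1-\alpha)}\int_{-z_0}^{z}K(z,\tau)U(\tau)\,d\tau\Big)^{\frac1{m+1}},\qquad -z_0\le z\le 0,$$ which does not vanish identically on any interval $[-z_0,-z_0+\varepsilon)\cap[-z_0,0]$, $\varepsilon>0$. For every $z_0>0$ let $U(\cdot\,;z_0)$ be a nontrivial solution with half-width $z_0$. Then there is exactly one $z_0^*>0$ with $\int_{-z_0^*}^0U(z;z_0^*)\,dz=\frac12$. With this $z_0^*$ define, for $x\in\mathbb R$, $$u(x,t)=t^{-\frac{\alpha}{2+m}}\begin{cases}U\big(-|x|t^{-\frac{\alpha}{2+m}};z_0^*\big),&|x|\le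 z_0^*t^{\frac{\alpha}{2+m}},\\0,&\text{otherwise},\end{cases}\qquad t>0,$$ and $u(x,0)=0$. Let $t_0>0$ be arbitrary. Then the following hold. 1. (Strong solution.) Let $0<z_1<z_2<z_0^*$, $t\ge t_0$ and $x\in\mathbb R$ with $z_1\le|x|t^{-\frac{\alpha}{2+m}}\le z_2$. Then $u(x,\cdot)$ is absolutely continuous on $[0,t]$ and differentiable at $t$; $\tau\mapsto(t-\tau)^{-\alpha}u_t(x,\tau)$ is integrable on $(0,t)$; $u(\cdot,t)$ is differentiable near $x$ and twice differentiable at $x$; $u^mu_x$ is differentiable in space at $(x,t)$; and $$\frac{1}{\Gamma(1-\alpha)}\int_0^t(t-\tau)^{-\alpha}u_t(x,\tau)\,d\tau=\big(u^mu_x\big)_x(x,t),$$ that is, $\partial_t^\alpha u=(u^mu_x)_x$ at $(x,t)$ with the Caputo derivative $\partial_t^\alpha$. 2. (Mass conservation.) The even extension of $U(\cdot\,;z_0^*)$ by zero to $\mathbb R$ is integrable with integral $1$, and for every $t\ge t_0$ the function $u(\cdot,t)$ is integrable with $\int_{-\infty}^{\infty}u(x,t)\,dx=1$. -/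

import Mathlib

open MeasureTheory Set Filter
open scoped Topology Interval

noncomputable section

namespace FracPME

/-- The similarity exponent `α / (2 + m)`. -/
def simExp (α m : ℝ) : ℝ := α / (2 + m)

/-- The constant `A = 1 - α - α / (2 + m)` of the self-similar equation. -/
def coefA (α m : ℝ) : ℝ := 1 - α - α / (2 + m)

/-- The constant `B = α / (2 + m)` of the self-similar equation. -/
def coefB (α m : ℝ) : ℝ := α / (2 + m)

/-- The kernel `K(z, τ)`, for `τ ≤ z ≤ 0`, of the Volterra equation. -/
def kernelK (α m z τ : ℝ) : ℝ :=
  ∫ σ in ((z / τ) ^ ((2 + m) / α))..1,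
    ((coefA α m + coefB α m) * (z - τ * σ ^ (α / (2 + m)))
      - coefB α m * τ * σ ^ (α / (2 + m))) * (1 - σ) ^ (-α)

/-- `U` is a continuous non-negative solution on `[-z₀, 0]` of
`U(z) = ((m+1)/Γ(1-α) ∫_{-z₀}^z K(z,τ) U(τ) dτ)^{1/(m+1)}`.
Values of `U` outside `[-z₀, 0]` play no role. -/
structure IsProfile (α m z₀ : ℝ) (U : ℝ → ℝ) : Prop where
  continuousOn : ContinuousOn U (Icc (-z₀) 0)
  nonneg : ∀ z ∈ Icc (-z₀) 0, 0 ≤ U z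
  eqn : ∀ z ∈ Icc (-z₀) 0,
    U z = ((m + 1) / Real.Gamma (1 - α) * ∫ τ in (-z₀)..z, kernelK α m z τ * U τ)
      ^ (1 / (m + 1))

/-- A nontrivial solution: its support reaches the endpoint `-z₀`, so that `z₀` really is the
half-width of the support of the even extension. A solution for a smaller half-width, extended
by zero, solves the equation as well; it is trivial near `-z₀` and is not admitted. -/
structure IsNontrivialProfile (α m z₀ : ℝ) (U : ℝ → ℝ) : Prop extends IsProfile α m z₀ U where
  nontrivial : ∀ ε > 0, ∃ z ∈ Icc (-z₀) 0, z < -z₀ + ε ∧ U z ≠ 0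

/-- The even extension of `U` to the real line, by zero outside `[-z₀, z₀]`. -/
def evenProfile (z₀ : ℝ) (U : ℝ → ℝ) (z : ℝ) : ℝ :=
  if |z| ≤ z₀ then U (-|z|) else 0

/-- The self-similar function
`u(x,t) = t^{-α/(2+m)} U(-|x| t^{-α/(2+m)})` for `|x| ≤ z₀ t^{α/(2+m)}` and `0` otherwise,
for all `t > 0`; at `t = 0` it is `0` (the medium is initially dry). -/
def barenblatt (α m z₀ : ℝ) (U : ℝ → ℝ) (x t : ℝ) : ℝ :=
  if 0 < t ∧ |x| ≤ z₀ * t ^ simExp α m then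
    t ^ (-simExp α m) * U (-(|x| * t ^ (-simExp α m)))
  else 0

/-- The Caputo derivative of order `α` of `f` at time `t`. -/
def caputo (α : ℝ) (f : ℝ → ℝ) (t : ℝ) : ℝ :=
  1 / Real.Gamma (1 - α) * ∫ τ in (0 : ℝ)..t, (t - τ) ^ (-α) * deriv f τ

/-- `u` is a strong (pointwise) solution of `∂_t^α u = (u^m u_x)_x` at `(x, t)`: all derivatives
in the equation exist in the ordinary sense, the Caputo derivative is a convergent integral of
an absolutely continuous function of time, and the two sides agree. -/
structure IsStrongSolutionAt (α m : ℝ) (u : ℝ → ℝ → ℝ) (x t : ℝ) : Prop where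
  /-- `u` is differentiable in time at `(x, t)`. -/
  time_diff : DifferentiableAt ℝ (fun s => u x s) t
  /-- The history `s ↦ u(x,s)` is absolutely continuous on `[0, t]`. -/
  abs_cont : AbsolutelyContinuousOnInterval (fun s => u x s) 0 t
  /-- The integral in the Caputo derivative converges absolutely. -/
  caputo_integrable :
    IntervalIntegrable (fun τ => (t - τ) ^ (-α) * deriv (fun s => u x s) τ) volume 0 t
  /-- `u(·, t)` is differentiable near `x`. -/
  space_diff : ∀ᶠ y in 𝓝 x, DifferentiableAt ℝ (fun y' => u y' t) y
  /-- `u(·, t)` is twice differentiable at `x`. -/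
  space_diff_two : DifferentiableAt ℝ (fun y => deriv (fun y' => u y' t) y) x
  /-- The equation: `u^m u_x` is differentiable in space at `(x, t)` and its derivative is the
  Caputo derivative of `u` there. -/
  eqn : HasDerivAt (fun y => (u y t) ^ m * deriv (fun y' => u y' t) y)
    (caputo α (fun s => u x s) t) x

end FracPME

end

/-! Write B = α/(2+m) and let F = `dilationMean α B W` be the weighted mean of the dilates
W(wσ^(-B)) of a profile W. The substitution w = τσ^B and Fubini turn the singular kernel into one
affine in z and w (`integral_kernelK_mul`): W^(m+1) is a constant times ∫ ((1-α)(z-w) - Bw) F(w) dw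
over [-z₀, z].

Half-width. The operator is order preserving, and the exponent 1/(m+1) makes it sublinear: W₁ ≤ cW₂
improves to W₁ ≤ c^(1/(m+1)) W₂, and iteration drives the constant to 1 (`ExtProfile.le_of_lt`).
Since F commutes with dilations, l^(2/m) W(·/l) is again a profile (`ExtProfile.scale`); comparing
with such dilates and letting l ↓ 1 gives uniqueness for each half-width. Hence all profiles are
rescalings of one, the half-mass is a positive constant times z₀^(2/m+1), and it takes the value 1/2
exactly once.

Equation. Differentiating the integral equation gives Γ(1-α) W^m W' = (1-α)∫F - BzF, whose
derivative, once F is differentiable, is (1-α-B)F - BzF'. On the time side, the Riemann–Liouville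
integral of the history s ↦ u(x,s) is r^(1-α-B) F(-|x|r^(-B)) (`integral_history`), and its time
derivative contains the same combination. Differentiability of F is the delicate point, because W'
may blow up at the front. It is read off from the same identity: the history is the primitive of an
integrable function (W is monotone), so its Riemann–Liouville integral is differentiable after the
front has arrived (`hasDerivAt_riemannLiouville`), and F is recovered by a smooth change of time.

Mass. The prefactor t^(-B) cancels the Jacobian of x ↦ xt^(-B), so the mass is that of the even
profile at every positive time. -/

namespace FracPME

/-! ### The weighted dilation mean -/

/-- The weight `(1 - σ)^(-α) σ^(-B)` on `(0, 1)`. -/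
noncomputable def weight (α B σ : ℝ) : ℝ := (1 - σ) ^ (-α) * σ ^ (-B)

/-- `∫₀¹ (1 - σ)^(-α) σ^(-B) W(w σ^(-B)) dσ`. -/
noncomputable def dilationMean (α B : ℝ) (W : ℝ → ℝ) (w : ℝ) : ℝ :=
  ∫ σ in Ioo (0 : ℝ) 1, weight α B σ * W (w * σ ^ (-B))

/-- The integrand of the kernel as a function of `w = τ σ^B`. -/
def kernelP (α B z w : ℝ) : ℝ := (1 - α) * (z - w) - B * w

lemma weight_nonneg {α B σ : ℝ} (h : σ ∈ Ioo (0 : ℝ) 1) : 0 ≤ weight α B σ :=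
  mul_nonneg (Real.rpow_nonneg (by linarith [h.2]) _) (Real.rpow_nonneg h.1.le _)

lemma weight_pos {α B σ : ℝ} (h : σ ∈ Ioo (0 : ℝ) 1) : 0 < weight α B σ :=
  mul_pos (Real.rpow_pos_of_pos (by linarith [h.2]) _) (Real.rpow_pos_of_pos h.1 _)

lemma measurable_weight (α B : ℝ) : Measurable (weight α B) := by
  unfold weight; fun_prop

lemma integrableOn_one_sub_rpow {α : ℝ} (h1 : α < 1) :
    IntegrableOn (fun σ : ℝ => (1 - σ) ^ (-α)) (Ioo 0 1) := by
  have h := (intervalIntegral.intervalIntegrable_rpow' (a := 0) (b := 1) (r := -α)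
    (by linarith)).comp_sub_left 1
  simp only [sub_zero, sub_self] at h
  exact ((intervalIntegrable_iff_integrableOn_Ioo_of_le zero_le_one).1 h.symm)

lemma integrableOn_weight {α B : ℝ} (h0 : 0 < α) (h1 : α < 1) (hB0 : 0 < B) (hB : B < 1) :
    IntegrableOn (weight α B) (Ioo 0 1) := by
  have hi2 : IntegrableOn (fun σ : ℝ => σ ^ (-B)) (Ioo 0 1) :=
    (intervalIntegrable_iff_integrableOn_Ioo_of_le zero_le_one).1
      (intervalIntegral.intervalIntegrable_rpow' (by linarith))
  refine Integrable.mono' (((integrableOn_one_sub_rpow h1).const_mul 2).add (hi2.const_mul 2))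
    (measurable_weight α B).aestronglyMeasurable ?_
  filter_upwards [ae_restrict_mem measurableSet_Ioo] with σ hσ
  -- On either side of σ = 1/2 only one of the two factors is singular; the other is at most 2.
  have key : ∀ {s r : ℝ}, 1 / 2 ≤ s → 0 < r → r < 1 → s ^ (-r) ≤ 2 := by
    intro s r hs hr hr1
    calc s ^ (-r) ≤ (1 / 2 : ℝ) ^ (-r) :=
          Real.rpow_le_rpow_of_nonpos (by norm_num) hs (by linarith)
      _ = 2 ^ r := by rw [Real.rpow_neg (by norm_num), ← Real.inv_rpow (by norm_num)]; norm_num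
      _ ≤ 2 ^ (1 : ℝ) := Real.rpow_le_rpow_of_exponent_le (by norm_num) hr1.le
      _ = 2 := by norm_num
  have ha : 0 ≤ (1 - σ) ^ (-α) := Real.rpow_nonneg (by linarith [hσ.2]) _
  have hb : 0 ≤ σ ^ (-B) := Real.rpow_nonneg hσ.1.le _
  rw [Real.norm_of_nonneg (weight_nonneg hσ)]
  simp only [weight, Pi.add_apply]
  rcases le_total (1 / 2) σ with h | h
  · nlinarith [mul_le_mul_of_nonneg_left (key h hB0 hB) ha]
  · nlinarith [mul_le_mul_of_nonneg_right (key (s := 1 - σ) (by linarith) h0 h1) hb]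

lemma integrableOn_dilationMean {α B M : ℝ} (h0 : 0 < α) (h1 : α < 1) (hB0 : 0 < B) (hB : B < 1)
    {W : ℝ → ℝ} (hW : Continuous W) (hM : ∀ z, |W z| ≤ M) (w : ℝ) :
    IntegrableOn (fun σ => weight α B σ * W (w * σ ^ (-B))) (Ioo 0 1) := by
  have hm : Measurable fun σ : ℝ => W (w * σ ^ (-B)) := hW.measurable.comp (by fun_prop)
  exact Integrable.mul_bdd (c := M) (integrableOn_weight h0 h1 hB0 hB) hm.aestronglyMeasurable
    (Eventually.of_forall fun _ => hM _)

lemma continuous_dilationMean {α B M : ℝ} (h0 : 0 < α) (h1 : α < 1) (hB0 : 0 < B) (hB : B < 1)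
    {W : ℝ → ℝ} (hW : Continuous W) (hM : ∀ z, |W z| ≤ M) :
    Continuous (dilationMean α B W) := by
  refine continuous_of_dominated (bound := fun σ => weight α B σ * M) (fun w => ?_) (fun w => ?_)
    ((integrableOn_weight h0 h1 hB0 hB).mul_const M) (Eventually.of_forall fun _ => ?_)
  · exact (integrableOn_dilationMean h0 h1 hB0 hB hW hM w).aestronglyMeasurable
  · filter_upwards [ae_restrict_mem measurableSet_Ioo] with σ hσ
    rw [norm_mul, Real.norm_of_nonneg (weight_nonneg hσ)]
    exact mul_le_mul_of_nonneg_left (hM _) (weight_nonneg hσ)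
  · exact continuous_const.mul (hW.comp (continuous_id.mul continuous_const))

/-- The dilations move negative points to the left, so the mean at w sees W only on (-∞, w]. This
gives the operator its Volterra character. -/
lemma le_mul_rpow_neg {σ B w : ℝ} (hB0 : 0 < B) (hσ : σ ∈ Ioo (0 : ℝ) 1) (hw : w ≤ 0) :
    w * σ ^ (-B) ≤ w := by
  have : 1 ≤ σ ^ (-B) := Real.one_le_rpow_of_pos_of_le_one_of_nonpos hσ.1 hσ.2.le (by linarith)
  nlinarith

lemma dilationMean_nonneg {α B : ℝ} {W : ℝ → ℝ} (hW : ∀ z, 0 ≤ W z) (w : ℝ) :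
    0 ≤ dilationMean α B W w :=
  setIntegral_nonneg measurableSet_Ioo fun _ hσ => mul_nonneg (weight_nonneg hσ) (hW _)

lemma dilationMean_eq_zero {α B a : ℝ} (hB0 : 0 < B) {W : ℝ → ℝ} (ha : a ≤ 0)
    (hW : ∀ z ≤ a, W z = 0) {w : ℝ} (hw : w ≤ a) : dilationMean α B W w = 0 := by
  refine setIntegral_eq_zero_of_forall_eq_zero fun σ hσ => ?_
  rw [hW _ ((le_mul_rpow_neg hB0 hσ (hw.trans ha)).trans hw), mul_zero]

lemma dilationMean_mono {α B M N : ℝ} (h0 : 0 < α) (h1 : α < 1) (hB0 : 0 < B) (hB : B < 1)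
    {W W' : ℝ → ℝ} (hW : Continuous W) (hM : ∀ z, |W z| ≤ M) (hW' : Continuous W')
    (hN : ∀ z, |W' z| ≤ N) (h : ∀ z ≤ 0, W z ≤ W' z) {w : ℝ} (hw : w ≤ 0) :
    dilationMean α B W w ≤ dilationMean α B W' w :=
  setIntegral_mono_on (integrableOn_dilationMean h0 h1 hB0 hB hW hM w)
    (integrableOn_dilationMean h0 h1 hB0 hB hW' hN w) measurableSet_Ioo fun _ hσ =>
      mul_le_mul_of_nonneg_left (h _ ((le_mul_rpow_neg hB0 hσ hw).trans hw)) (weight_nonneg hσ)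

lemma dilationMean_scale {α B c l : ℝ} {W : ℝ → ℝ} (w : ℝ) :
    dilationMean α B (fun z => c * W (z / l)) w = c * dilationMean α B W (w / l) := by
  unfold dilationMean
  rw [← integral_const_mul]
  congr 1; ext σ
  dsimp only
  rw [mul_div_right_comm]; ring

/-- A mean is positive as soon as the function is positive somewhere on the left. -/
lemma dilationMean_pos {α B M : ℝ} (h0 : 0 < α) (h1 : α < 1) (hB0 : 0 < B) (hB : B < 1)
    {W : ℝ → ℝ} (hW : Continuous W) (hM : ∀ z, |W z| ≤ M) (hnn : ∀ z, 0 ≤ W z) {v w : ℝ}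
    (hv : 0 < W v) (hvw : v < w) (hw : w < 0) : 0 < dilationMean α B W w := by
  -- The solution of wσ^(-B) = v: at this σ the mean samples W at v, and by continuity the integrand
  -- is positive on an open set around it.
  set σ₀ : ℝ := (w / v) ^ (1 / B) with hσ₀
  have hv0 : v < 0 := hvw.trans hw
  have hw' : w ≠ 0 := hw.ne
  have hq0 : 0 < w / v := div_pos_of_neg_of_neg hw hv0
  have hq1 : w / v < 1 := (div_lt_one_of_neg hv0).2 hvw
  have hσ : σ₀ ∈ Ioo (0 : ℝ) 1 :=
    ⟨Real.rpow_pos_of_pos hq0 _, Real.rpow_lt_one hq0.le hq1 (by positivity)⟩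
  have hval : w * σ₀ ^ (-B) = v := by
    rw [hσ₀, ← Real.rpow_mul hq0.le, show 1 / B * -B = -1 by field_simp, Real.rpow_neg_one]
    field_simp
  have hco : ContinuousOn (fun σ => weight α B σ * W (w * σ ^ (-B))) (Ioo 0 1) := by
    unfold weight
    have e1 : ContinuousOn (fun σ : ℝ => (1 - σ) ^ (-α)) (Ioo 0 1) :=
      ContinuousOn.rpow_const (by fun_prop) fun σ hσ => Or.inl (by linarith [hσ.2])
    have e2 : ContinuousOn (fun σ : ℝ => σ ^ (-B)) (Ioo 0 1) :=
      ContinuousOn.rpow_const (by fun_prop) fun σ hσ => Or.inl hσ.1.ne'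
    exact (e1.mul e2).mul (hW.comp_continuousOn (continuousOn_const.mul e2))
  unfold dilationMean
  rw [setIntegral_pos_iff_support_of_nonneg_ae
    ((ae_restrict_mem measurableSet_Ioo).mono fun σ hσ => mul_nonneg (weight_nonneg hσ) (hnn _))
    (integrableOn_dilationMean h0 h1 hB0 hB hW hM w)]
  have hopen := hco.isOpen_inter_preimage isOpen_Ioo (isOpen_Ioi (a := (0 : ℝ)))
  have hmem : σ₀ ∈ Ioo (0 : ℝ) 1 ∩ (fun σ => weight α B σ * W (w * σ ^ (-B))) ⁻¹' Ioi 0 :=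
    ⟨hσ, by simpa [hval] using mul_pos (weight_pos hσ) hv⟩
  refine (hopen.measure_pos volume ⟨_, hmem⟩).trans_le (measure_mono ?_)
  rintro σ ⟨h1, h2⟩
  exact ⟨ne_of_gt h2, h1⟩

/-! ### The Volterra operator in terms of the dilation mean -/

/-- The kernel integrand, cut off at `w = z`. -/
noncomputable def cutP (α B z w : ℝ) : ℝ := if w < z then kernelP α B z w else 0

lemma measurable_cutP (α B z : ℝ) : Measurable (cutP α B z) := by
  unfold cutP kernelP
  exact Measurable.ite measurableSet_Iio (by fun_prop) measurable_const

/-- The lower limit (z/τ)^(1/B) is exactly the σ at which τσ^B crosses z, and the coefficients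
satisfy A + B = 1 - α. Moving the limit into a cutoff frees the domain from z and τ, as Fubini
requires. -/
lemma kernelK_eq {α m z τ : ℝ} (h0 : 0 < α) (hm : 0 < m) (hτ : τ < z) (hz : z ≤ 0) :
    kernelK α m z τ = ∫ σ in Ioo (0 : ℝ) 1,
      cutP α (α / (2 + m)) z (τ * σ ^ (α / (2 + m))) * (1 - σ) ^ (-α) := by
  set B := α / (2 + m) with hB
  have hB0 : 0 < B := by positivity
  have hτ0 : τ < 0 := hτ.trans_le hz
  have hq0 : 0 ≤ z / τ := div_nonneg_of_nonpos hz hτ0.le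
  have hq1 : z / τ < 1 := (div_lt_one_of_neg hτ0).2 hτ
  have hexp : (2 + m) / α = B⁻¹ := by rw [hB, inv_div]
  unfold kernelK
  rw [hexp]
  set r := (z / τ) ^ B⁻¹ with hr
  have hr0 : 0 ≤ r := Real.rpow_nonneg hq0 _
  have hr1 : r < 1 := Real.rpow_lt_one hq0 hq1 (by positivity)
  have hiff : ∀ σ ∈ Ioo (0 : ℝ) 1, (σ ∈ Ioo r 1 ↔ τ * σ ^ B < z) := by
    intro σ hσ
    have : τ * σ ^ B < z ↔ z / τ < σ ^ B := by
      rw [div_lt_iff_of_neg hτ0, mul_comm]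
    rw [this, hr, ← Real.rpow_inv_lt_iff_of_pos hq0 hσ.1.le hB0]
    exact ⟨fun h => h.1, fun h => ⟨h, hσ.2⟩⟩
  rw [intervalIntegral.integral_of_le hr1.le, integral_Ioc_eq_integral_Ioo,
    ← integral_indicator measurableSet_Ioo, ← integral_indicator measurableSet_Ioo]
  congr 1; ext σ
  by_cases hσ : σ ∈ Ioo (0 : ℝ) 1
  · rw [indicator_of_mem hσ]
    by_cases hlt : τ * σ ^ B < z
    · rw [indicator_of_mem ((hiff σ hσ).2 hlt), cutP, if_pos hlt, kernelP, coefA, coefB, ← hB]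
      ring
    · rw [indicator_of_notMem (fun h => hlt ((hiff σ hσ).1 h)), cutP, if_neg hlt, zero_mul]
  · rw [indicator_of_notMem hσ, indicator_of_notMem fun h => hσ ⟨hr0.trans_lt h.1, h.2⟩]

lemma abs_cutP_le {α B z₀ z w : ℝ} (h0 : 0 < α) (h1 : α < 1) (hB0 : 0 < B) (hB : B < 1)
    (hz : z ≤ 0) (hw : -z₀ ≤ w) (hz0 : 0 ≤ z₀) :
    |cutP α B z w| ≤ 2 * z₀ := by
  unfold cutP
  split_ifs with h
  · have e : 0 ≤ kernelP α B z w := by unfold kernelP; nlinarith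
    rw [abs_of_nonneg e]
    unfold kernelP; nlinarith
  · simpa using hz0

/-- Exchange the integrals and substitute w = τσ^B for fixed σ; the Jacobian σ^(-B) completes the
weight, and exchanging back collects the σ-integral into the mean. Both exchanges are dominated by a
constant on [-z₀, 0] times an integrable function of σ. -/
lemma integral_kernelK_mul {α m z₀ z M : ℝ} (h0 : 0 < α) (h1 : α < 1) (hm : 0 < m)
    {W : ℝ → ℝ} (hW : Continuous W) (hM : ∀ z, |W z| ≤ M) (hzero : ∀ z ≤ -z₀, W z = 0)
    (hz0 : 0 ≤ z₀) (hz : z ∈ Icc (-z₀) 0) :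
    ∫ τ in (-z₀)..z, kernelK α m z τ * W τ =
      ∫ w in (-z₀)..z, kernelP α (α / (2 + m)) z w * dilationMean α (α / (2 + m)) W w := by
  set B := α / (2 + m) with hBdef
  have hB0 : 0 < B := by positivity
  have hB : B < 1 := by rw [hBdef, div_lt_one (by positivity)]; linarith
  have hM0 : 0 ≤ M := (abs_nonneg _).trans (hM 0)
  have hcut : ∀ τ, z ≤ τ → ∀ σ ∈ Ioo (0 : ℝ) 1, cutP α B z (τ * σ ^ B) = 0 := by
    intro τ hτ σ hσ
    have hs0 : 0 < σ ^ B := Real.rpow_pos_of_pos hσ.1 _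
    have hs1 : σ ^ B ≤ 1 := Real.rpow_le_one hσ.1.le hσ.2.le hB0.le
    refine if_neg (not_lt.2 ?_)
    rcases le_total τ 0 with h | h
    · nlinarith
    · nlinarith [hz.2]
  have hL : ∫ τ in (-z₀)..z, kernelK α m z τ * W τ =
      ∫ τ, ∫ σ in Ioo (0 : ℝ) 1, cutP α B z (τ * σ ^ B) * (1 - σ) ^ (-α) * W τ := by
    rw [intervalIntegral.integral_of_le hz.1, integral_Ioc_eq_integral_Ioo,
      ← integral_indicator measurableSet_Ioo]
    congr 1; ext τ
    by_cases hτ : τ ∈ Ioo (-z₀) z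
    · rw [indicator_of_mem hτ, kernelK_eq h0 hm hτ.2 hz.2, ← integral_mul_const]
    · rw [indicator_of_notMem hτ]
      symm
      refine setIntegral_eq_zero_of_forall_eq_zero fun σ hσ => ?_
      by_cases hτ1 : τ ≤ -z₀
      · rw [hzero _ hτ1, mul_zero]
      · rw [hcut τ (not_lt.1 fun h => hτ ⟨not_le.1 hτ1, h⟩) σ hσ, zero_mul, zero_mul]
  have hR : ∫ w in (-z₀)..z, kernelP α B z w * dilationMean α B W w =
      ∫ w, ∫ σ in Ioo (0 : ℝ) 1, weight α B σ * (cutP α B z w * W (w * σ ^ (-B))) := by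
    rw [intervalIntegral.integral_of_le hz.1, integral_Ioc_eq_integral_Ioo,
      ← integral_indicator measurableSet_Ioo]
    congr 1; ext w
    have e : ∫ σ in Ioo (0 : ℝ) 1, weight α B σ * (cutP α B z w * W (w * σ ^ (-B))) =
        cutP α B z w * dilationMean α B W w := by
      rw [dilationMean, ← integral_const_mul]
      congr 1; ext σ; ring
    rw [e]
    by_cases hw : w ∈ Ioo (-z₀) z
    · rw [indicator_of_mem hw, cutP, if_pos hw.2]
    · rw [indicator_of_notMem hw]
      by_cases hw1 : w ≤ -z₀
      · rw [dilationMean_eq_zero hB0 (by linarith) hzero hw1, mul_zero]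
      · rw [cutP, if_neg fun h => hw ⟨not_le.1 hw1, h⟩, zero_mul]
  have hind : Integrable (indicator (Icc (-z₀) 0) fun _ : ℝ => (2 * z₀ * M : ℝ)) :=
    (integrable_indicator_iff measurableSet_Icc).2
      (integrableOn_const (by simp))
  have hσm : ∀ᵐ p ∂(volume : Measure ℝ).prod (volume.restrict (Ioo (0 : ℝ) 1)),
      p.2 ∈ Ioo (0 : ℝ) 1 :=
    Measure.quasiMeasurePreserving_snd.ae (ae_restrict_mem measurableSet_Ioo)
  have hi1 : Integrable (Function.uncurry fun τ σ : ℝ =>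
      cutP α B z (τ * σ ^ B) * (1 - σ) ^ (-α) * W τ)
      ((volume : Measure ℝ).prod (volume.restrict (Ioo (0 : ℝ) 1))) := by
    refine Integrable.mono' (hind.mul_prod (integrableOn_one_sub_rpow h1)) ?_ ?_
    · refine Measurable.aestronglyMeasurable ?_
      have := measurable_cutP α B z
      have := hW.measurable
      unfold Function.uncurry
      fun_prop
    · filter_upwards [hσm] with p hp
      obtain ⟨τ, σ⟩ := p
      have hs : 0 ≤ (1 - σ) ^ (-α) := Real.rpow_nonneg (by linarith [hp.2]) _
      simp only [Function.uncurry_apply_pair, norm_mul, Real.norm_eq_abs, abs_of_nonneg hs]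
      by_cases hτ : τ ∈ Icc (-z₀) 0
      · rw [indicator_of_mem hτ]
        have hs0 : 0 < σ ^ B := Real.rpow_pos_of_pos hp.1 _
        have hs1 : σ ^ B ≤ 1 := Real.rpow_le_one hp.1.le hp.2.le hB0.le
        have e1 := abs_cutP_le h0 h1 hB0 hB hz.2 (w := τ * σ ^ B) (z₀ := z₀)
          (by nlinarith [hτ.1, hτ.2]) hz0
        calc |cutP α B z (τ * σ ^ B)| * (1 - σ) ^ (-α) * |W τ|
            = (|cutP α B z (τ * σ ^ B)| * |W τ|) * (1 - σ) ^ (-α) := by ring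
          _ ≤ _ := mul_le_mul_of_nonneg_right
            (mul_le_mul e1 (hM τ) (abs_nonneg _) (by positivity)) hs
      · rw [indicator_of_notMem hτ, zero_mul]
        apply le_of_eq
        by_cases hτ1 : τ ≤ -z₀
        · rw [hzero _ hτ1, abs_zero, mul_zero]
        · rw [hcut τ (by by_contra h; exact hτ ⟨(not_le.1 hτ1).le, by linarith [hz.2]⟩) σ hp,
            abs_zero, zero_mul, zero_mul]
  have hi2 : Integrable (Function.uncurry fun w σ : ℝ =>
      weight α B σ * (cutP α B z w * W (w * σ ^ (-B))))
      ((volume : Measure ℝ).prod (volume.restrict (Ioo (0 : ℝ) 1))) := by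
    refine Integrable.mono' (hind.mul_prod (integrableOn_weight h0 h1 hB0 hB)) ?_ ?_
    · refine Measurable.aestronglyMeasurable ?_
      have := measurable_cutP α B z
      have := measurable_weight α B
      have := hW.measurable
      unfold Function.uncurry
      fun_prop
    · filter_upwards [hσm] with p hp
      obtain ⟨w, σ⟩ := p
      have hs : 0 ≤ weight α B σ := weight_nonneg hp
      simp only [Function.uncurry_apply_pair, norm_mul, Real.norm_eq_abs, abs_of_nonneg hs]
      by_cases hw : w ∈ Icc (-z₀) 0
      · rw [indicator_of_mem hw, mul_comm]
        exact mul_le_mul_of_nonneg_right (mul_le_mul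
          (abs_cutP_le h0 h1 hB0 hB hz.2 hw.1 hz0) (hM _) (abs_nonneg _) (by positivity)) hs
      · rw [indicator_of_notMem hw, zero_mul]
        apply le_of_eq
        by_cases hw1 : w ≤ -z₀
        · rw [hzero _ ((le_mul_rpow_neg hB0 hp (by linarith)).trans hw1), abs_zero, mul_zero,
            mul_zero]
        · rw [cutP, if_neg, abs_zero, zero_mul, mul_zero]
          intro h
          exact hw ⟨(not_le.1 hw1).le, h.le.trans hz.2⟩
  rw [hL, hR, integral_integral_swap hi1, integral_integral_swap hi2]
  refine setIntegral_congr_fun measurableSet_Ioo fun σ hσ => ?_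
  have hs0 : 0 < σ ^ B := Real.rpow_pos_of_pos hσ.1 _
  have hsub := Measure.integral_comp_mul_right
    (fun w => (1 - σ) ^ (-α) * (cutP α B z w * W (w * σ ^ (-B)))) (σ ^ B)
  have hneg : σ ^ (-B) = (σ ^ B)⁻¹ := Real.rpow_neg hσ.1.le _
  have e1 : ∀ w, w * σ ^ B * σ ^ (-B) = w := fun w => by rw [hneg]; field_simp
  simp only [e1, abs_of_pos (inv_pos.2 hs0), smul_eq_mul] at hsub
  simp only [weight]
  calc ∫ τ, cutP α B z (τ * σ ^ B) * (1 - σ) ^ (-α) * W τ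
      = ∫ τ, (1 - σ) ^ (-α) * (cutP α B z (τ * σ ^ B) * W τ) := by congr 1; ext τ; ring
    _ = _ := by
      rw [hsub, ← integral_const_mul, hneg]
      congr 1; ext w; ring

end FracPME

namespace FracPME

/-! ### Profiles extended to the real line -/

/-- A nontrivial profile extended continuously to `ℝ`, its equation being written with the
dilation mean. -/
structure ExtProfile (α m z₀ : ℝ) (W : ℝ → ℝ) : Prop where
  cont : Continuous W
  nonneg : ∀ z, 0 ≤ W z
  zero : ∀ z ≤ -z₀, W z = 0
  pos : ∀ z, -z₀ < z → 0 < W z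
  bdd : ∃ M, ∀ z, |W z| ≤ M
  eqn : ∀ z ∈ Icc (-z₀) 0, W z ^ (m + 1) = (m + 1) / Real.Gamma (1 - α) *
    ∫ w in (-z₀)..z, kernelP α (α / (2 + m)) z w * dilationMean α (α / (2 + m)) W w

lemma simExp_pos {α m : ℝ} (h0 : 0 < α) (hm : 0 < m) : 0 < α / (2 + m) := by positivity

lemma simExp_lt_one {α m : ℝ} (h1 : α < 1) (hm : 0 < m) : α / (2 + m) < 1 := by
  rw [div_lt_one (by positivity)]; linarith

lemma kernelP_nonneg {α B z w : ℝ} (h1 : α < 1) (hB0 : 0 < B) (hw : w ≤ z) (hz : z ≤ 0) :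
    0 ≤ kernelP α B z w := by
  unfold kernelP; nlinarith

lemma continuous_kernelP (α B z : ℝ) : Continuous (kernelP α B z) := by
  unfold kernelP; fun_prop

lemma coef_pos {α m : ℝ} (h1 : α < 1) (hm : 0 < m) : 0 < (m + 1) / Real.Gamma (1 - α) :=
  div_pos (by linarith) (Real.Gamma_pos_of_pos (by linarith))

/-- Extend U by its endpoint values. At -z₀ the integral is empty, so the left extension is zero.
Nontriviality supplies positive values arbitrarily near -z₀; the mean, and with it the integral, is
then positive further to the right. -/
lemma IsNontrivialProfile.exists_extProfile {α m z₀ : ℝ} {U : ℝ → ℝ} (h0 : 0 < α) (h1 : α < 1)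
    (hm : 0 < m) (hz0 : 0 < z₀) (hU : IsNontrivialProfile α m z₀ U) :
    ∃ W, ExtProfile α m z₀ W ∧ ∀ z ∈ Icc (-z₀) 0, W z = U z := by
  have hle : -z₀ ≤ 0 := by linarith
  have hB0 := simExp_pos h0 hm
  have hB := simExp_lt_one h1 hm
  set W : ℝ → ℝ := IccExtend hle ((Icc (-z₀) 0).domRestrict U) with hWdef
  have hWeq : ∀ z ∈ Icc (-z₀) 0, W z = U z := fun z hz => by
    rw [hWdef, IccExtend_of_mem _ _ hz]; rfl
  have hWU : ∀ z, ∃ y ∈ Icc (-z₀) 0, W z = U y := fun z => ⟨_, (projIcc _ _ hle z).2, rfl⟩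
  have hcont : Continuous W := (continuousOn_iff_continuous_domRestrict.1 hU.continuousOn).Icc_extend'
  have hnn : ∀ z, 0 ≤ W z := fun z => by
    obtain ⟨y, hy, e⟩ := hWU z
    exact e ▸ hU.nonneg y hy
  have hbdd : ∃ M, ∀ z, |W z| ≤ M := by
    obtain ⟨M, hM⟩ := isCompact_Icc.exists_bound_of_continuousOn hU.continuousOn
    exact ⟨M, fun z => by obtain ⟨y, hy, e⟩ := hWU z; exact e ▸ hM y hy⟩
  have hU0 : U (-z₀) = 0 := by
    rw [hU.eqn _ ⟨le_rfl, hle⟩, intervalIntegral.integral_same, mul_zero,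
      Real.zero_rpow (by positivity)]
  have hzero : ∀ z ≤ -z₀, W z = 0 := fun z hz => by
    rw [hWdef, IccExtend_of_le_left _ _ hz]; exact hU0
  obtain ⟨M, hM⟩ := hbdd
  have heq : ∀ z ∈ Icc (-z₀) 0, W z = ((m + 1) / Real.Gamma (1 - α) * ∫ w in (-z₀)..z,
      kernelP α (α / (2 + m)) z w * dilationMean α (α / (2 + m)) W w) ^ (1 / (m + 1)) := by
    intro z hz
    rw [hWeq z hz, hU.eqn z hz, ← integral_kernelK_mul h0 h1 hm hcont hM hzero hz0.le hz]
    congr 2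
    refine intervalIntegral.integral_congr fun τ hτ => ?_
    rw [uIcc_of_le hz.1] at hτ
    rw [hWeq τ ⟨hτ.1, hτ.2.trans hz.2⟩]
  have hcF := continuous_dilationMean h0 h1 hB0 hB hcont hM
  have hnnint : ∀ z ∈ Icc (-z₀) 0, 0 ≤ ∫ w in (-z₀)..z,
      kernelP α (α / (2 + m)) z w * dilationMean α (α / (2 + m)) W w := fun z hz =>
    intervalIntegral.integral_nonneg hz.1 fun w hw =>
      mul_nonneg (kernelP_nonneg h1 hB0 hw.2 hz.2) (dilationMean_nonneg hnn w)
  have hpos : ∀ z ∈ Ioc (-z₀) 0, 0 < W z := by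
    intro z hz
    -- This choice of ε places v to the left of z; the integrand is then positive at the midpoint of
    -- v and z.
    obtain ⟨v, hv, hvz, hne⟩ := hU.nontrivial (z + z₀) (by linarith [hz.1])
    have hvW : 0 < W v := lt_of_le_of_ne (hnn v) (by rw [hWeq v hv]; exact hne.symm)
    have hvz' : v < z := by linarith
    rw [heq z ⟨hz.1.le, hz.2⟩]
    refine Real.rpow_pos_of_pos (mul_pos (coef_pos h1 hm) ?_) _
    refine intervalIntegral.integral_pos hz.1
      ((continuous_kernelP _ _ _).mul hcF).continuousOn
      (fun w hw => mul_nonneg (kernelP_nonneg h1 hB0 hw.2 hz.2) (dilationMean_nonneg hnn w))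
      ⟨(v + z) / 2, ⟨by linarith [hv.1], by linarith⟩, mul_pos ?_ ?_⟩
    · unfold kernelP
      nlinarith [hz.2]
    · exact dilationMean_pos h0 h1 hB0 hB hcont hM hnn hvW (by linarith) (by linarith [hz.2])
  refine ⟨W, ⟨hcont, hnn, hzero, fun z hz => ?_, ⟨M, hM⟩, fun z hz => ?_⟩, hWeq⟩
  · rcases le_total z 0 with h | h
    · exact hpos z ⟨hz, h⟩
    · have : W z = W 0 := by
        rw [hWdef, IccExtend_of_right_le _ _ h, IccExtend_right]
      exact this ▸ hpos 0 ⟨by linarith, le_rfl⟩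
  · conv_lhs => rw [heq z hz]
    rw [← Real.rpow_mul (mul_nonneg (coef_pos h1 hm).le (hnnint z hz)), one_div,
      inv_mul_cancel₀ (by positivity), Real.rpow_one]

/-! ### Comparison, scaling and uniqueness of profiles -/

/-- Comparison: the profile of larger half-width is the larger one. -/
lemma ExtProfile.le_of_lt {α m z₁ z₂ : ℝ} {W₁ W₂ : ℝ → ℝ} (h0 : 0 < α) (h1 : α < 1)
    (hm : 0 < m) (hz1 : 0 < z₁) (hlt : z₁ < z₂) (H₁ : ExtProfile α m z₁ W₁)
    (H₂ : ExtProfile α m z₂ W₂) {z : ℝ} (hz : z ≤ 0) : W₁ z ≤ W₂ z := by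
  have hB0 := simExp_pos h0 hm
  have hB := simExp_lt_one h1 hm
  obtain ⟨M₁, hM₁⟩ := H₁.bdd
  obtain ⟨M₂, hM₂⟩ := H₂.bdd
  -- A crude constant to start from: since z₁ < z₂, W₂ has a positive minimum on [-z₁, 0], while W₁
  -- vanishes to the left of it.
  obtain ⟨b, hb1, hb⟩ : ∃ b : ℝ, 1 ≤ b ∧ ∀ z ≤ 0, W₁ z ≤ b * W₂ z := by
    obtain ⟨y, hy, hmin⟩ := (isCompact_Icc (a := -z₁) (b := 0)).exists_isMinOn
      ⟨0, by constructor <;> linarith⟩ H₂.cont.continuousOn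
    have hc : 0 < W₂ y := H₂.pos y (by linarith [hy.1])
    refine ⟨max 1 (M₁ / W₂ y), le_max_left _ _, fun z hz => ?_⟩
    rcases le_total z (-z₁) with h | h
    · rw [H₁.zero z h]
      exact mul_nonneg (zero_le_one.trans (le_max_left _ _)) (H₂.nonneg z)
    · calc W₁ z ≤ M₁ := (le_abs_self _).trans (hM₁ z)
        _ = M₁ / W₂ y * W₂ y := by field_simp
        _ ≤ M₁ / W₂ y * W₂ z := mul_le_mul_of_nonneg_left (hmin ⟨h, hz⟩)
            (div_nonneg ((abs_nonneg _).trans (hM₁ z)) hc.le)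
        _ ≤ _ := mul_le_mul_of_nonneg_right (le_max_right _ _) (H₂.nonneg z)
  -- One application of the equation passes the factor c through the linear integral and then takes
  -- its (m+1)-th root.
  have step : ∀ c : ℝ, 0 < c → (∀ z ≤ 0, W₁ z ≤ c * W₂ z) →
      ∀ z ≤ 0, W₁ z ≤ c ^ (1 / (m + 1)) * W₂ z := by
    intro c hc hle z hz
    have hcp : 0 < c ^ (1 / (m + 1)) := Real.rpow_pos_of_pos hc _
    rcases le_total z (-z₁) with h | h
    · rw [H₁.zero z h]
      exact mul_nonneg hcp.le (H₂.nonneg z)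
    have hF : ∀ w ≤ 0, dilationMean α (α / (2 + m)) W₁ w ≤
        c * dilationMean α (α / (2 + m)) W₂ w := by
      intro w hw
      have e := dilationMean_scale (α := α) (B := α / (2 + m)) (c := c) (l := 1) (W := W₂) w
      simp only [div_one] at e
      rw [← e]
      exact dilationMean_mono h0 h1 hB0 hB H₁.cont hM₁ (continuous_const.mul H₂.cont)
        (N := |c| * M₂) (fun z => by
          change |c * W₂ z| ≤ _
          rw [abs_mul]; exact mul_le_mul_of_nonneg_left (hM₂ z) (abs_nonneg c)) hle hw
    have hc1 := (continuous_kernelP α (α / (2 + m)) z).mul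
      (continuous_dilationMean h0 h1 hB0 hB H₁.cont hM₁)
    have hc2 := (continuous_kernelP α (α / (2 + m)) z).mul
      (continuous_dilationMean h0 h1 hB0 hB H₂.cont hM₂)
    have hint : ∫ w in (-z₁)..z, kernelP α (α / (2 + m)) z w *
          dilationMean α (α / (2 + m)) W₁ w ≤
        c * ∫ w in (-z₂)..z, kernelP α (α / (2 + m)) z w *
          dilationMean α (α / (2 + m)) W₂ w := by
      calc _ ≤ ∫ w in (-z₁)..z, c * (kernelP α (α / (2 + m)) z w *
              dilationMean α (α / (2 + m)) W₂ w) := by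
            refine intervalIntegral.integral_mono_on h (hc1.intervalIntegrable _ _)
              ((hc2.const_mul c).intervalIntegrable _ _) fun w hw => ?_
            have := mul_le_mul_of_nonneg_left (hF w (hw.2.trans hz))
              (kernelP_nonneg h1 hB0 hw.2 hz)
            linarith
        _ = c * ∫ w in (-z₁)..z, kernelP α (α / (2 + m)) z w *
              dilationMean α (α / (2 + m)) W₂ w := intervalIntegral.integral_const_mul _ _
        _ ≤ _ := by
            refine mul_le_mul_of_nonneg_left ?_ hc.le
            refine intervalIntegral.integral_mono_interval (by linarith) h le_rfl ?_
              (hc2.intervalIntegrable _ _)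
            filter_upwards [ae_restrict_mem measurableSet_Ioc] with w hw
            exact mul_nonneg (kernelP_nonneg h1 hB0 hw.2 hz) (dilationMean_nonneg H₂.nonneg w)
    have hpow : W₁ z ^ (m + 1) ≤ (c ^ (1 / (m + 1)) * W₂ z) ^ (m + 1) := by
      rw [Real.mul_rpow hcp.le (H₂.nonneg z), ← Real.rpow_mul hc.le, one_div,
        inv_mul_cancel₀ (by positivity), Real.rpow_one, H₁.eqn z ⟨h, hz⟩,
        H₂.eqn z ⟨by linarith, hz⟩, mul_left_comm]
      exact mul_le_mul_of_nonneg_left hint (coef_pos h1 hm).le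
    exact (Real.rpow_le_rpow_iff (H₁.nonneg z) (mul_nonneg hcp.le (H₂.nonneg z))
      (by positivity)).1 hpow
  have hb0 : 0 < b := by linarith
  -- The exponent tends to 0 because m > 0, so the constant tends to 1.
  have iter : ∀ n : ℕ, ∀ z ≤ 0, W₁ z ≤ b ^ ((1 / (m + 1)) ^ n) * W₂ z := by
    intro n
    induction n with
    | zero => simpa using hb
    | succ n ih =>
      have := step _ (Real.rpow_pos_of_pos hb0 _) ih
      simpa only [← Real.rpow_mul hb0.le, ← pow_succ] using this
  have hlim : Tendsto (fun n : ℕ => b ^ ((1 / (m + 1)) ^ n) * W₂ z) atTop (𝓝 (1 * W₂ z)) := by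
    refine Tendsto.mul_const _ ?_
    have hq : Tendsto (fun n : ℕ => (1 / (m + 1)) ^ n) atTop (𝓝 0) :=
      tendsto_pow_atTop_nhds_zero_of_lt_one (by positivity)
        ((div_lt_one (by positivity)).2 (by linarith))
    simpa [Function.comp_def] using
      (Real.continuous_const_rpow hb0.ne').continuousAt.tendsto.comp hq
  rw [one_mul] at hlim
  exact ge_of_tendsto' hlim fun n => iter n z hz

/-- The scaling `W ↦ l^(2/m) W(· / l)` of profiles. -/
lemma ExtProfile.scale {α m z₀ l : ℝ} {W : ℝ → ℝ} (hm : 0 < m) (hl : 0 < l)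
    (H : ExtProfile α m z₀ W) : ExtProfile α m (l * z₀) fun z => l ^ (2 / m) * W (z / l) := by
  have hc : 0 < l ^ (2 / m) := Real.rpow_pos_of_pos hl _
  refine ⟨continuous_const.mul (H.cont.comp (continuous_id.div_const l)),
    fun z => mul_nonneg hc.le (H.nonneg _), fun z hz => ?_, fun z hz => ?_, ?_, fun z hz => ?_⟩
  · rw [H.zero _ (by rw [div_le_iff₀ hl]; linarith), mul_zero]
  · exact mul_pos hc (H.pos _ (by rw [lt_div_iff₀ hl]; linarith))
  · obtain ⟨M, hM⟩ := H.bdd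
    exact ⟨l ^ (2 / m) * M, fun z => by
      rw [abs_mul, abs_of_pos hc]; exact mul_le_mul_of_nonneg_left (hM _) hc.le⟩
  · have hz' : z / l ∈ Icc (-z₀) 0 :=
      ⟨by rw [le_div_iff₀ hl]; linarith [hz.1], div_nonpos_of_nonpos_of_nonneg hz.2 hl.le⟩
    -- This identity dictates the exponent 2/m: the right side of the equation gains l², one power
    -- from the kernel, homogeneous of degree one, and one from dw.
    have hcm : (l ^ (2 / m)) ^ (m + 1) = l ^ (2 / m) * l ^ 2 := by
      rw [Real.rpow_add_one hc.ne', ← Real.rpow_mul hl.le, div_mul_cancel₀ _ hm.ne',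
        Real.rpow_two, mul_comm]
    rw [Real.mul_rpow hc.le (H.nonneg _), hcm, H.eqn _ hz']
    simp only [dilationMean_scale]
    have hsub := intervalIntegral.integral_comp_div (a := -(l * z₀)) (b := z) (c := l)
      (fun w => kernelP α (α / (2 + m)) (z / l) w * dilationMean α (α / (2 + m)) W w) hl.ne'
    have e : -(l * z₀) / l = -z₀ := by field_simp
    rw [e, smul_eq_mul] at hsub
    have e2 : ∫ w in -(l * z₀)..z, kernelP α (α / (2 + m)) z w *
          (l ^ (2 / m) * dilationMean α (α / (2 + m)) W (w / l)) =
        l ^ (2 / m) * l * ∫ w in -(l * z₀)..z, kernelP α (α / (2 + m)) (z / l) (w / l) *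
          dilationMean α (α / (2 + m)) W (w / l) := by
      rw [← intervalIntegral.integral_const_mul]
      congr 1; ext w
      unfold kernelP
      field_simp
    rw [e2, hsub]
    ring

/-- For l > 1 the dilate of W₂ has the strictly larger half-width lz₀ and so dominates W₁; let l ↓
1. -/
lemma ExtProfile.le_of_eq {α m z₀ : ℝ} {W₁ W₂ : ℝ → ℝ} (h0 : 0 < α) (h1 : α < 1)
    (hm : 0 < m) (hz0 : 0 < z₀) (H₁ : ExtProfile α m z₀ W₁)
    (H₂ : ExtProfile α m z₀ W₂) {z : ℝ} (hz : z ≤ 0) : W₁ z ≤ W₂ z := by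
  have hev : ∀ᶠ l in 𝓝[>] (1 : ℝ), W₁ z ≤ l ^ (2 / m) * W₂ (z / l) := by
    filter_upwards [self_mem_nhdsWithin] with l hl
    have hl1 : 1 < l := hl
    exact H₁.le_of_lt h0 h1 hm hz0 (by nlinarith) (H₂.scale hm (by linarith)) hz
  have hc : ContinuousAt (fun l : ℝ => l ^ (2 / m) * W₂ (z / l)) 1 :=
    (Real.continuousAt_rpow_const _ _ (Or.inl one_ne_zero)).mul
      (H₂.cont.continuousAt.comp (continuousAt_const.div continuousAt_id one_ne_zero))
  have hlim : Tendsto (fun l : ℝ => l ^ (2 / m) * W₂ (z / l)) (𝓝[>] 1) (𝓝 (W₂ z)) := by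
    have := hc.tendsto
    simp only [Real.one_rpow, one_mul, div_one] at this
    exact this.mono_left nhdsWithin_le_nhds
  exact ge_of_tendsto hlim hev

/-- Uniqueness of the nontrivial profile with given half-width. -/
lemma ExtProfile.unique {α m z₀ : ℝ} {W₁ W₂ : ℝ → ℝ} (h0 : 0 < α) (h1 : α < 1)
    (hm : 0 < m) (hz0 : 0 < z₀) (H₁ : ExtProfile α m z₀ W₁)
    (H₂ : ExtProfile α m z₀ W₂) {z : ℝ} (hz : z ≤ 0) : W₁ z = W₂ z :=
  le_antisymm (H₁.le_of_eq h0 h1 hm hz0 H₂ hz) (H₂.le_of_eq h0 h1 hm hz0 H₁ hz)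

/-- There is exactly one half-width of half-mass `1 / 2`. -/
lemma existsUnique_halfWidth {α m : ℝ} (h0 : 0 < α) (h1 : α < 1) (hm : 0 < m)
    {U : ℝ → ℝ → ℝ} (hU : ∀ z₀ : ℝ, 0 < z₀ → IsNontrivialProfile α m z₀ (U z₀)) :
    ∃! zs : ℝ, 0 < zs ∧ ∫ z in (-zs)..0, U zs z = 1 / 2 := by
  obtain ⟨W, HW, hWU⟩ := (hU 1 one_pos).exists_extProfile h0 h1 hm one_pos
  set I := ∫ z in (-1)..0, W z with hI
  have hIpos : 0 < I :=
    intervalIntegral.integral_pos (by norm_num) HW.cont.continuousOn (fun z _ => HW.nonneg z)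
      ⟨0, by norm_num, HW.pos 0 (by norm_num)⟩
  -- By uniqueness every profile is the dilate of the one of half-width 1.
  have hmass : ∀ z₀ : ℝ, 0 < z₀ → ∫ z in (-z₀)..0, U z₀ z = z₀ ^ (2 / m + 1) * I := by
    intro z₀ hz0
    obtain ⟨W', HW', hWU'⟩ := (hU z₀ hz0).exists_extProfile h0 h1 hm hz0
    have hs := HW.scale hm hz0
    rw [mul_one] at hs
    calc ∫ z in (-z₀)..0, U z₀ z = ∫ z in (-z₀)..0, z₀ ^ (2 / m) * W (z / z₀) := by
          refine intervalIntegral.integral_congr fun z hz => ?_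
          rw [uIcc_of_le (by linarith)] at hz
          rw [← hWU' z hz]
          exact HW'.unique h0 h1 hm hz0 hs hz.2
      _ = _ := by
          rw [intervalIntegral.integral_const_mul,
            intervalIntegral.integral_comp_div (fun z => W z) hz0.ne', zero_div, neg_div,
            div_self hz0.ne', Real.rpow_add_one hz0.ne', smul_eq_mul, mul_assoc]
  have hp : 2 / m + 1 ≠ 0 := by positivity
  refine ⟨(1 / 2 / I) ^ (2 / m + 1)⁻¹, ⟨Real.rpow_pos_of_pos (by positivity) _, ?_⟩, ?_⟩
  · rw [hmass _ (Real.rpow_pos_of_pos (by positivity) _), Real.rpow_inv_rpow (by positivity) hp]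
    field_simp
  · rintro y ⟨hy, hy2⟩
    rw [hmass y hy] at hy2
    rw [← hy2, mul_div_cancel_right₀ _ hIpos.ne', Real.rpow_rpow_inv hy.le hp]

end FracPME

namespace FracPME

/-! ### Differentiating Riemann–Liouville integrals -/

/-- The kernel `v^(-α)` on `(0, T)`, extended by zero. -/
noncomputable def truncKernel (α T : ℝ) : ℝ → ℝ := indicator (Ioo 0 T) fun v => v ^ (-α)

lemma integrable_truncKernel {α : ℝ} (h1 : α < 1) (T : ℝ) : Integrable (truncKernel α T) := by
  refine (integrable_indicator_iff measurableSet_Ioo).2 ?_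
  rcases le_total 0 T with hT | hT
  · exact (intervalIntegrable_iff_integrableOn_Ioo_of_le hT).1
      (intervalIntegral.intervalIntegrable_rpow' (by linarith))
  · simp [Ioo_eq_empty (not_lt.2 hT)]

lemma truncKernel_nonneg (α T v : ℝ) : 0 ≤ truncKernel α T v := by
  unfold truncKernel
  by_cases hv : v ∈ Ioo 0 T
  · rw [indicator_of_mem hv]; exact Real.rpow_nonneg hv.1.le _
  · rw [indicator_of_notMem hv]

lemma truncKernel_of_mem {α T v : ℝ} (h0 : 0 < v) (hT : v < T) : truncKernel α T v = v ^ (-α) :=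
  indicator_of_mem (mem_Ioo.2 ⟨h0, hT⟩) _

lemma continuousAt_truncKernel {α T v : ℝ} (hv : v ∈ Ioo 0 T) :
    ContinuousAt (truncKernel α T) v := by
  refine (Real.continuousAt_rpow_const v (-α) (Or.inl hv.1.ne')).congr ?_
  filter_upwards [isOpen_Ioo.mem_nhds hv] with x hx
  exact (truncKernel_of_mem hx.1 hx.2).symm

/-- After v = r - s, the vanishing of φ on (-∞, 0] allows the range of v to be enlarged to (0, T).
The kernel no longer depends on r and is integrable on the whole line. -/
lemma integral_eq_truncKernel {α T r : ℝ} {φ : ℝ → ℝ} (hr : 0 < r) (hrT : r < T)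
    (hφ : ∀ s ≤ 0, φ s = 0) :
    ∫ s in (0 : ℝ)..r, (r - s) ^ (-α) * φ s = ∫ v, truncKernel α T v * φ (r - v) := by
  have e := intervalIntegral.integral_comp_sub_left (a := 0) (b := r)
    (fun v => v ^ (-α) * φ (r - v)) r
  simp only [sub_sub_cancel, sub_self, sub_zero] at e
  rw [e, intervalIntegral.integral_of_le hr.le, integral_Ioc_eq_integral_Ioo,
    ← integral_indicator measurableSet_Ioo]
  congr 1; ext v
  unfold truncKernel
  by_cases hv : v ∈ Ioo 0 r
  · rw [indicator_of_mem hv, ← truncKernel_of_mem hv.1 (hv.2.trans hrT), truncKernel]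
  · rw [indicator_of_notMem hv]
    by_cases h0 : 0 < v
    · rw [hφ (r - v) (by by_contra h; exact hv ⟨h0, by linarith⟩), mul_zero]
    · rw [indicator_of_notMem fun h => h0 h.1, zero_mul]

section RiemannLiouville

variable {α s₀ t : ℝ} {p : ℝ → ℝ}

/-- A cutoff splits off the singularity of `p` at `s₀`. -/
lemma exists_cutoff_split (hst : s₀ < t) (hp0 : ∀ s ≤ s₀, p s = 0)
    (hpc : ContinuousOn p (Ioi s₀)) (hpi : ∀ T, IntegrableOn p (Iic T)) :
    ∃ c g h, s₀ < c ∧ c < t ∧ Continuous g ∧ (∀ s ≤ s₀, g s = 0) ∧ Integrable h ∧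
      (∀ s ∉ Ioo s₀ c, h s = 0) ∧ ∀ s, p s = g s + h s := by
  set c := (s₀ + t) / 2 with hc
  set c₀ := (s₀ + c) / 2 with hc₀
  have h1 : s₀ < c := by linarith
  have h2 : c < t := by linarith
  have h3 : s₀ < c₀ := by linarith
  have h4 : c₀ < c := by linarith
  set ψ : ℝ → ℝ := fun s => max 0 (min 1 ((s - c₀) / (c - c₀))) with hψ
  have hψc : Continuous ψ := by
    rw [hψ]
    exact continuous_const.max (continuous_const.min
      ((continuous_id.sub continuous_const).div_const _))
  have hψ0 : ∀ s ≤ c₀, ψ s = 0 := fun s hs => by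
    have : (s - c₀) / (c - c₀) ≤ 0 := div_nonpos_of_nonpos_of_nonneg (by linarith) (by linarith)
    exact max_eq_left ((min_le_right _ _).trans this)
  have hψ1 : ∀ s, c ≤ s → ψ s = 1 := fun s hs => by
    have : 1 ≤ (s - c₀) / (c - c₀) := by rw [le_div_iff₀ (by linarith)]; linarith
    simp [hψ, min_eq_left this]
  have hψb : ∀ s, ‖1 - ψ s‖ ≤ 1 := fun s => by
    have a1 : 0 ≤ ψ s := le_max_left _ _
    have a2 : ψ s ≤ 1 := max_le zero_le_one (min_le_left _ _)
    rw [Real.norm_eq_abs, abs_le]; constructor <;> linarith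
  -- Clamping at c₀ keeps the argument where p is continuous; it changes nothing, because ψ vanishes
  -- up to c₀.
  have hgc : Continuous fun s => ψ s * p (max s c₀) := by
    refine hψc.mul (hpc.comp_continuous (continuous_id.max continuous_const) fun s => ?_)
    exact h3.trans_le (le_max_right _ _)
  have hg : ∀ s, ψ s * p (max s c₀) = ψ s * p s := fun s => by
    rcases le_total s c₀ with hs | hs
    · rw [hψ0 s hs, zero_mul, zero_mul]
    · rw [max_eq_left hs]
  have hzero : ∀ s ∉ Ioo s₀ c, (1 - ψ s) * p s = 0 := by
    intro s hs
    rcases le_total s s₀ with h | h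
    · rw [hp0 s h, mul_zero]
    · rcases h.eq_or_lt with h | h
      · rw [hp0 s h.ge, mul_zero]
      · rw [hψ1 s (not_lt.1 fun h' => hs ⟨h, h'⟩), sub_self, zero_mul]
  refine ⟨c, fun s => ψ s * p (max s c₀), fun s => (1 - ψ s) * p s, h1, h2, hgc, ?_, ?_, hzero, ?_⟩
  · intro s hs
    simp only
    rw [hψ0 s (hs.trans h3.le), zero_mul]
  · rw [← integrableOn_iff_integrable_of_support_subset (s := Iic c)]
    · exact (hpi c).bdd_mul (continuous_const.sub hψc).aestronglyMeasurable
        (Eventually.of_forall hψb)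
    · intro s hs
      by_contra h
      exact hs (hzero s fun h' => h h'.2.le)
  · intro s
    simp only
    rw [hg]; ring

lemma exists_bound_of_zero {g : ℝ → ℝ} (hg : Continuous g) (h0 : ∀ s ≤ s₀, g s = 0) (T : ℝ) :
    ∃ M, 0 ≤ M ∧ ∀ s ≤ T, ‖g s‖ ≤ M := by
  obtain ⟨M, hM⟩ := (isCompact_Icc (a := s₀) (b := T)).exists_bound_of_continuousOn
    hg.continuousOn
  refine ⟨max 0 M, le_max_left _ _, fun s hs => ?_⟩
  rcases le_total s s₀ with h | h
  · rw [h0 s h, norm_zero]; exact le_max_left _ _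
  · exact (hM s ⟨h, hs⟩).trans (le_max_right _ _)

/-- The kernel is singular at s = t and p may be singular at s₀, so the two are separated by p = g +
h. For the continuous g, the parameter r stays in g and the integrable kernel dominates; for h,
supported in (s₀, c) with c < t, r is moved into the kernel, which is bounded and continuous there.
-/
lemma riemannLiouville_aux (h0 : 0 < α) (h1 : α < 1) (hs0 : 0 < s₀) (hst : s₀ < t)
    (hp0 : ∀ s ≤ s₀, p s = 0) (hpc : ContinuousOn p (Ioi s₀))
    (hpi : ∀ T, IntegrableOn p (Iic T)) :
    Integrable (fun v => truncKernel α (t + 1) v * p (t - v)) ∧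
      ContinuousAt (fun r => ∫ v, truncKernel α (t + 1) v * p (r - v)) t := by
  set T := t + 1 with hT
  obtain ⟨c, g, h, hc1, hc2, hgc, hg0, hhi, hh0, hsum⟩ := exists_cutoff_split hst hp0 hpc hpi
  obtain ⟨M, hM0, hM⟩ := exists_bound_of_zero hgc hg0 T
  have hk := integrable_truncKernel h1 T
  set t' := (c + t) / 2 with ht'
  have hnear : ∀ᶠ r in 𝓝 t, r ∈ Ioo t' T := isOpen_Ioo.mem_nhds ⟨by linarith, by linarith⟩
  have hgb : ∀ r ∈ Ioo t' T, ∀ v, ‖truncKernel α T v * g (r - v)‖ ≤ truncKernel α T v * M := by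
    intro r hr v
    rw [norm_mul, Real.norm_of_nonneg (truncKernel_nonneg _ _ _)]
    by_cases hv : v ∈ Ioo 0 T
    · exact mul_le_mul_of_nonneg_left (hM _ (by linarith [hv.1, hr.2])) (truncKernel_nonneg _ _ _)
    · rw [truncKernel, indicator_of_notMem hv, zero_mul, zero_mul]
  have hgm : ∀ r, AEStronglyMeasurable (fun v => truncKernel α T v * g (r - v)) := fun r =>
    hk.aestronglyMeasurable.mul (hgc.comp (continuous_const.sub continuous_id)).aestronglyMeasurable
  have hgi : ∀ r ∈ Ioo t' T, Integrable fun v => truncKernel α T v * g (r - v) := fun r hr =>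
    (hk.mul_const M).mono' (hgm r) (Eventually.of_forall (hgb r hr))
  have hhb : ∀ r ∈ Ioo t' T, ∀ s, ‖truncKernel α T (r - s) * h s‖ ≤ (t' - c) ^ (-α) * ‖h s‖ := by
    intro r hr s
    by_cases hs : s ∈ Ioo s₀ c
    · rw [norm_mul, Real.norm_of_nonneg (truncKernel_nonneg _ _ _)]
      refine mul_le_mul_of_nonneg_right ?_ (norm_nonneg _)
      rw [truncKernel_of_mem (by linarith [hs.2, hr.1]) (by linarith [hs.1, hr.2])]
      exact Real.rpow_le_rpow_of_nonpos (by linarith) (by linarith [hs.2, hr.1]) (by linarith)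
    · rw [hh0 s hs]; simp
  have hhm : ∀ r, AEStronglyMeasurable (fun s => truncKernel α T (r - s) * h s) := fun r =>
    (hk.comp_sub_left r).aestronglyMeasurable.mul hhi.aestronglyMeasurable
  have hhi' : ∀ r ∈ Ioo t' T, Integrable fun s => truncKernel α T (r - s) * h s := fun r hr =>
    (hhi.norm.const_mul _).mono' (hhm r) (Eventually.of_forall (hhb r hr))
  have hhi2 : ∀ r ∈ Ioo t' T, Integrable fun v => truncKernel α T v * h (r - v) := fun r hr => by
    simpa using (hhi' r hr).comp_sub_left r
  have htm : t ∈ Ioo t' T := ⟨by linarith, by linarith⟩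
  refine ⟨?_, ?_⟩
  · simp only [hsum, mul_add]
    exact (hgi t htm).add (hhi2 t htm)
  · have hc_g : ContinuousAt (fun r => ∫ v, truncKernel α T v * g (r - v)) t :=
      continuousAt_of_dominated (Eventually.of_forall hgm)
        (hnear.mono fun r hr => Eventually.of_forall (hgb r hr)) (hk.mul_const M)
        (Eventually.of_forall fun v => by fun_prop)
    have hc_h : ContinuousAt (fun r => ∫ s, truncKernel α T (r - s) * h s) t := by
      refine continuousAt_of_dominated (Eventually.of_forall hhm)
        (hnear.mono fun r hr => Eventually.of_forall (hhb r hr)) (hhi.norm.const_mul _)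
        (Eventually.of_forall fun s => ?_)
      by_cases hs : s ∈ Ioo s₀ c
      · refine ContinuousAt.mul ?_ continuousAt_const
        exact ContinuousAt.comp (f := fun r => r - s)
          (continuousAt_truncKernel ⟨by linarith [hs.2], by linarith [hs.1]⟩) (by fun_prop)
      · simp only [hh0 s hs, mul_zero]
        exact continuousAt_const
    refine (hc_g.add hc_h).congr ?_
    filter_upwards [hnear] with r hr
    have e : ∫ s, truncKernel α T (r - s) * h s = ∫ v, truncKernel α T v * h (r - v) := by
      simpa using integral_sub_left_eq_self
        (fun v => truncKernel α T v * h (r - v)) (μ := volume) r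
    simp only [Pi.add_apply]
    rw [e, ← integral_add (hgi r hr) (hhi2 r hr)]
    simp only [hsum, mul_add]

lemma intervalIntegrable_riemannLiouville (h0 : 0 < α) (h1 : α < 1) (hs0 : 0 < s₀) (hst : s₀ < t)
    (hp0 : ∀ s ≤ s₀, p s = 0) (hpc : ContinuousOn p (Ioi s₀))
    (hpi : ∀ T, IntegrableOn p (Iic T)) :
    IntervalIntegrable (fun s => (t - s) ^ (-α) * p s) volume 0 t := by
  have h := ((riemannLiouville_aux h0 h1 hs0 hst hp0 hpc hpi).1.comp_sub_left t).integrableOn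
    (s := Ioo 0 t)
  rw [intervalIntegrable_iff_integrableOn_Ioo_of_le (hs0.trans hst).le]
  refine h.congr_fun (fun s hs => ?_) measurableSet_Ioo
  simp only [sub_sub_cancel]
  rw [truncKernel_of_mem (by linarith [hs.2]) (by linarith [hs.1])]

/-- The Riemann–Liouville integral of a primitive of `p` is differentiable, with derivative the
Riemann–Liouville integral of `p`. -/
lemma hasDerivAt_riemannLiouville (h0 : 0 < α) (h1 : α < 1) (hs0 : 0 < s₀) (hst : s₀ < t)
    (hp0 : ∀ s ≤ s₀, p s = 0) (hpc : ContinuousOn p (Ioi s₀))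
    (hpi : ∀ T, IntegrableOn p (Iic T)) {f : ℝ → ℝ} (hf : ∀ s, f s = ∫ v in Iic s, p v) :
    HasDerivAt (fun r => ∫ s in (0 : ℝ)..r, (r - s) ^ (-α) * f s)
      (∫ s in (0 : ℝ)..t, (t - s) ^ (-α) * p s) t := by
  set T := t + 1 with hT
  have ht : 0 < t := hs0.trans hst
  -- Only values of p below T matter for r < T; truncation makes p globally integrable, so that
  -- convolution theory applies.
  set q : ℝ → ℝ := indicator (Iic T) p with hq
  have hqi : Integrable q := (integrable_indicator_iff measurableSet_Iic).2 (hpi T)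
  have hk := integrable_truncKernel h1 T
  have hconv : Integrable (fun x : ℝ × ℝ => truncKernel α T x.2 * q (x.1 - x.2)) :=
    hk.convolution_integrand (ContinuousLinearMap.mul ℝ ℝ) hqi
  set I : ℝ → ℝ := fun r => ∫ v, truncKernel α T v * q (r - v) with hI
  have hIi : Integrable I := hconv.integral_prod_left
  have hpq : ∀ r < T, ∀ v, truncKernel α T v * q (r - v) = truncKernel α T v * p (r - v) := by
    intro r hr v
    by_cases hv : v ∈ Ioo 0 T
    · rw [hq, indicator_of_mem (show r - v ∈ Iic T from (by linarith [hv.1] : r - v ≤ T))]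
    · rw [truncKernel, indicator_of_notMem hv, zero_mul, zero_mul]
  have hIp : ∀ r < T, I r = ∫ v, truncKernel α T v * p (r - v) := fun r hr => by
    simp only [hI, hpq r hr]
  have hlt : ∀ᶠ r in 𝓝 t, r < T := eventually_lt_nhds (by linarith)
  have hIc : ContinuousAt I t := by
    refine (riemannLiouville_aux h0 h1 hs0 hst hp0 hpc hpi).2.congr ?_
    filter_upwards [hlt] with r hr
    exact (hIp r hr).symm
  have hf0 : ∀ s ≤ 0, f s = 0 := fun s hs => by
    rw [hf]
    exact setIntegral_eq_zero_of_forall_eq_zero fun v hv =>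
      hp0 v ((show v ≤ s from hv).trans (hs.trans hs0.le))
  -- By Fubini, the Riemann–Liouville integral of f is itself the primitive of I. The claim then
  -- follows from the fundamental theorem of calculus, as I is continuous at t.
  have hJ : ∀ r, 0 < r → r < T →
      ∫ s in (0 : ℝ)..r, (r - s) ^ (-α) * f s = ∫ u in Iic r, I u := by
    intro r hr hrT
    rw [integral_eq_truncKernel hr hrT hf0]
    have hint : Integrable (Function.uncurry fun u v : ℝ => truncKernel α T v * q (u - v))
        ((volume.restrict (Iic r)).prod volume) := by
      rw [← Measure.restrict_univ (μ := (volume : Measure ℝ)), Measure.restrict_restrict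
        measurableSet_Iic, Measure.prod_restrict]
      exact hconv.integrableOn
    rw [hI, integral_integral_swap hint]
    congr 1; ext v
    rw [integral_const_mul]
    by_cases hv : v ∈ Ioo 0 T
    · congr 1
      rw [hf, ← integral_indicator measurableSet_Iic, ← integral_indicator measurableSet_Iic,
        ← integral_sub_right_eq_self _ v]
      congr 1; ext u
      by_cases hu : u ≤ r
      · rw [indicator_of_mem (show u - v ∈ Iic (r - v) by simpa using hu),
          indicator_of_mem (show u ∈ Iic r from hu), hq,
          indicator_of_mem (show u - v ∈ Iic T from (by linarith [hv.1] : u - v ≤ T))]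
      · rw [indicator_of_notMem (show u - v ∉ Iic (r - v) by simpa using hu),
          indicator_of_notMem (show u ∉ Iic r from hu)]
    · rw [truncKernel, indicator_of_notMem hv, zero_mul, zero_mul]
  rw [integral_eq_truncKernel ht (by linarith : t < T) fun s hs => hp0 s (hs.trans hs0.le),
    ← hIp t (by linarith)]
  have hd : HasDerivAt (fun r => (∫ u in Iic (0 : ℝ), I u) + ∫ u in (0 : ℝ)..r, I u) (I t) t :=
    (intervalIntegral.integral_hasDerivAt_right hIi.intervalIntegrable
      hIi.aestronglyMeasurable.stronglyMeasurableAtFilter hIc).const_add _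
  refine hd.congr_of_eventuallyEq ?_
  filter_upwards [hlt, eventually_gt_nhds ht] with r hr hr0
  rw [hJ r hr0 hr, ← intervalIntegral.integral_Iic_sub_Iic hIi.integrableOn hIi.integrableOn]
  ring

end RiemannLiouville

end FracPME

namespace FracPME

/-! ### Regularity of profiles -/

/-- `(1 - α) ∫_{-z₀}^z F - B z F(z)`, which is `Γ(1 - α) W^m W'`. -/
noncomputable def profileFlux (α B z₀ : ℝ) (W : ℝ → ℝ) (z : ℝ) : ℝ :=
  (1 - α) * (∫ w in (-z₀)..z, dilationMean α B W w) - B * z * dilationMean α B W z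

/-- The derivative of the profile inside its support. -/
noncomputable def profileDeriv (α m z₀ : ℝ) (W : ℝ → ℝ) (z : ℝ) : ℝ :=
  W z ^ (-m) * (profileFlux α (α / (2 + m)) z₀ W z / Real.Gamma (1 - α))

namespace ExtProfile

variable {α m z₀ : ℝ} {W : ℝ → ℝ}

lemma continuous_mean (h0 : 0 < α) (h1 : α < 1) (hm : 0 < m) (H : ExtProfile α m z₀ W) :
    Continuous (dilationMean α (α / (2 + m)) W) := by
  obtain ⟨M, hM⟩ := H.bdd
  exact continuous_dilationMean h0 h1 (simExp_pos h0 hm) (simExp_lt_one h1 hm) H.cont hM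

lemma hasDerivAt_integral_mean (h0 : 0 < α) (h1 : α < 1) (hm : 0 < m)
    (H : ExtProfile α m z₀ W) (z : ℝ) :
    HasDerivAt (fun z => ∫ w in (-z₀)..z, dilationMean α (α / (2 + m)) W w)
      (dilationMean α (α / (2 + m)) W z) z :=
  ((H.continuous_mean h0 h1 hm).integral_hasStrictDerivAt _ _).hasDerivAt

lemma continuous_flux (h0 : 0 < α) (h1 : α < 1) (hm : 0 < m) (H : ExtProfile α m z₀ W) :
    Continuous (profileFlux α (α / (2 + m)) z₀ W) := by
  have hF := H.continuous_mean h0 h1 hm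
  have hI : Continuous fun z => ∫ w in (-z₀)..z, dilationMean α (α / (2 + m)) W w :=
    continuous_iff_continuousAt.2 fun z => (H.hasDerivAt_integral_mean h0 h1 hm z).continuousAt
  unfold profileFlux
  fun_prop

/-- This sign makes the profile nondecreasing on (-z₀, 0), which later yields integrability of its
derivative up to the front without any rate. -/
lemma flux_nonneg (h0 : 0 < α) (h1 : α < 1) (hm : 0 < m) (H : ExtProfile α m z₀ W) {z : ℝ}
    (hz : -z₀ ≤ z) (hz' : z ≤ 0) : 0 ≤ profileFlux α (α / (2 + m)) z₀ W z := by
  have hB0 := simExp_pos h0 hm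
  have a1 : 0 ≤ ∫ w in (-z₀)..z, dilationMean α (α / (2 + m)) W w :=
    intervalIntegral.integral_nonneg hz fun w _ => dilationMean_nonneg H.nonneg w
  have a2 : 0 ≤ dilationMean α (α / (2 + m)) W z := dilationMean_nonneg H.nonneg z
  have a3 : 0 ≤ α / (2 + m) * (-z) * dilationMean α (α / (2 + m)) W z :=
    mul_nonneg (mul_nonneg hB0.le (by linarith)) a2
  unfold profileFlux
  nlinarith

/-- The kernel is affine in z, so W^(m+1) is a combination of z∫F and ∫wF, both differentiable
because F is continuous. The root may be differentiated because W > 0 inside the support. -/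
lemma hasDerivAt (h0 : 0 < α) (h1 : α < 1) (hm : 0 < m) (H : ExtProfile α m z₀ W) {z : ℝ}
    (hz : z ∈ Ioo (-z₀) 0) : HasDerivAt W (profileDeriv α m z₀ W z) z := by
  have hF := H.continuous_mean h0 h1 hm
  have hwF : Continuous fun w => w * dilationMean α (α / (2 + m)) W w := continuous_id.mul hF
  have hG := Real.Gamma_pos_of_pos (show 0 < 1 - α by linarith)
  have hWz := H.pos z hz.1
  have hV : HasDerivAt (fun z => W z ^ (m + 1))
      ((m + 1) / Real.Gamma (1 - α) * profileFlux α (α / (2 + m)) z₀ W z) z := by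
    have d1 := H.hasDerivAt_integral_mean h0 h1 hm z
    have d2 : HasDerivAt (fun z => ∫ w in (-z₀)..z, w * dilationMean α (α / (2 + m)) W w)
        (z * dilationMean α (α / (2 + m)) W z) z := (hwF.integral_hasStrictDerivAt _ _).hasDerivAt
    have d3 := (((((hasDerivAt_id z).mul d1).const_mul (1 - α)).sub
      (d2.const_mul (1 - α + α / (2 + m)))).const_mul ((m + 1) / Real.Gamma (1 - α)))
    refine (d3.congr_of_eventuallyEq ?_).congr_deriv ?_
    · filter_upwards [isOpen_Ioo.mem_nhds hz] with y hy
      have e : ∫ w in (-z₀)..y, kernelP α (α / (2 + m)) y w * dilationMean α (α / (2 + m)) W w =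
          (1 - α) * (y * ∫ w in (-z₀)..y, dilationMean α (α / (2 + m)) W w) -
            (1 - α + α / (2 + m)) * ∫ w in (-z₀)..y, w * dilationMean α (α / (2 + m)) W w := by
        simp only [← intervalIntegral.integral_const_mul]
        rw [← intervalIntegral.integral_sub
          (((hF.const_mul y).const_mul (1 - α)).intervalIntegrable _ _)
          ((hwF.const_mul _).intervalIntegrable _ _)]
        congr 1; ext w; unfold kernelP; ring
      rw [H.eqn y ⟨hy.1.le, hy.2.le⟩, e]
      rfl
    · unfold profileFlux
      simp only [id]
      ring
  have hVz : 0 < W z ^ (m + 1) := Real.rpow_pos_of_pos hWz _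
  have hd := hV.rpow_const (p := 1 / (m + 1)) (Or.inl hVz.ne')
  have hinv : ∀ x, (W x ^ (m + 1)) ^ (1 / (m + 1)) = W x := fun x => by
    rw [one_div, Real.rpow_rpow_inv (H.nonneg x) (by positivity)]
  simp only [hinv] at hd
  refine hd.congr_deriv ?_
  rw [← Real.rpow_mul hWz.le, show (m + 1) * (1 / (m + 1) - 1) = -m by field_simp; ring,
    profileDeriv]
  field_simp

lemma continuousOn_deriv (h0 : 0 < α) (h1 : α < 1) (hm : 0 < m) (H : ExtProfile α m z₀ W) :
    ContinuousOn (profileDeriv α m z₀ W) (Ioo (-z₀) 0) := by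
  unfold profileDeriv
  refine ContinuousOn.mul ?_ ((H.continuous_flux h0 h1 hm).div_const _).continuousOn
  exact H.cont.continuousOn.rpow_const fun z hz => Or.inl (H.pos z hz.1).ne'

lemma deriv_nonneg (h0 : 0 < α) (h1 : α < 1) (hm : 0 < m) (H : ExtProfile α m z₀ W) {z : ℝ}
    (hz : z ∈ Ioo (-z₀) 0) : 0 ≤ profileDeriv α m z₀ W z :=
  mul_nonneg (Real.rpow_nonneg (H.nonneg z) _) (div_nonneg
    (H.flux_nonneg h0 h1 hm hz.1.le hz.2.le) (Real.Gamma_pos_of_pos (by linarith)).le)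

end ExtProfile

/-! ### The history of the solution at a point -/

/-- The value at time `s` of the self-similar solution at distance `y` from the origin. -/
noncomputable def history (B : ℝ) (W : ℝ → ℝ) (y s : ℝ) : ℝ :=
  if 0 < s then s ^ (-B) * W (-(y * s ^ (-B))) else 0

/-- The time derivative of `history`, vanishing up to the arrival time `s₀`. -/
noncomputable def historyDeriv (α m z₀ : ℝ) (W : ℝ → ℝ) (y s₀ s : ℝ) : ℝ :=
  if s₀ < s then -(α / (2 + m)) * s ^ (-(α / (2 + m)) - 1) * W (-(y * s ^ (-(α / (2 + m))))) +
    s ^ (-(α / (2 + m))) * (profileDeriv α m z₀ W (-(y * s ^ (-(α / (2 + m))))) *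
      (y * (α / (2 + m)) * s ^ (-(α / (2 + m)) - 1))) else 0

lemma hasDerivAt_similarityVar {B y s : ℝ} (hs : 0 < s) :
    HasDerivAt (fun s : ℝ => -(y * s ^ (-B))) (y * B * s ^ (-B - 1)) s :=
  (((Real.hasDerivAt_rpow_const (p := -B) (Or.inl hs.ne')).const_mul y).neg).congr_deriv (by ring)

namespace ExtProfile

variable {α m z₀ : ℝ} {W : ℝ → ℝ}

/-- The front z₀s^B reaches the distance y at time (y/z₀)^(1/B). -/
lemma exists_arrival {B y : ℝ} (hB0 : 0 < B) (hz0 : 0 < z₀) (hy : 0 < y) :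
    ∃ s₀ : ℝ, 0 < s₀ ∧ ∀ s, 0 < s → (s₀ < s ↔ y * s ^ (-B) < z₀) := by
  refine ⟨(y / z₀) ^ B⁻¹, Real.rpow_pos_of_pos (by positivity) _, fun s hs => ?_⟩
  rw [Real.rpow_inv_lt_iff_of_pos (by positivity) hs.le hB0, Real.rpow_neg hs.le,
    ← div_eq_mul_inv, div_lt_iff₀ (Real.rpow_pos_of_pos hs _), div_lt_iff₀ hz0, mul_comm z₀]

section

variable {y s₀ : ℝ} (h0 : 0 < α) (h1 : α < 1) (hm : 0 < m) (hy : 0 < y) (hs0 : 0 < s₀)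
  (harr : ∀ s, 0 < s → (s₀ < s ↔ y * s ^ (-(α / (2 + m))) < z₀))

include hy hs0 harr

lemma similarityVar_mem {s : ℝ} (hs : s₀ < s) :
    -(y * s ^ (-(α / (2 + m)))) ∈ Ioo (-z₀) 0 := by
  have hs' := hs0.trans hs
  refine ⟨by linarith [(harr s hs').1 hs], ?_⟩
  have := mul_pos hy (Real.rpow_pos_of_pos hs' (-(α / (2 + m))))
  linarith

include h0 h1 hm

lemma hasDerivAt_history (H : ExtProfile α m z₀ W) {s : ℝ} (hs : s₀ < s) :
    HasDerivAt (history (α / (2 + m)) W y) (historyDeriv α m z₀ W y s₀ s) s := by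
  have hs' := hs0.trans hs
  have d1 := Real.hasDerivAt_rpow_const (x := s) (p := -(α / (2 + m))) (Or.inl hs'.ne')
  have d2 := (H.hasDerivAt h0 h1 hm (similarityVar_mem hy hs0 harr hs)).comp s
    (hasDerivAt_similarityVar (B := α / (2 + m)) (y := y) hs')
  refine ((d1.mul d2).congr_of_eventuallyEq ?_).congr_deriv ?_
  · filter_upwards [eventually_gt_nhds hs'] with r hr
    rw [history, if_pos hr]; rfl
  · rw [historyDeriv, if_pos hs]; rfl

omit h0 h1 hm hy hs0 in
lemma history_eq_zero (H : ExtProfile α m z₀ W) {s : ℝ} (hs : s ≤ s₀) :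
    history (α / (2 + m)) W y s = 0 := by
  unfold history
  split_ifs with h
  · rw [H.zero, mul_zero]
    have := not_lt.1 fun h' => not_lt.2 hs ((harr s h).2 h')
    linarith
  · rfl

lemma continuousOn_historyDeriv (H : ExtProfile α m z₀ W) :
    ContinuousOn (historyDeriv α m z₀ W y s₀) (Ioi s₀) := by
  have hr : ∀ r : ℝ, ContinuousOn (fun s : ℝ => s ^ r) (Ioi s₀) := fun r =>
    continuousOn_id.rpow_const fun s hs => Or.inl (hs0.trans hs).ne'
  have hζ : ContinuousOn (fun s : ℝ => -(y * s ^ (-(α / (2 + m))))) (Ioi s₀) :=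
    (continuousOn_const.mul (hr _)).neg
  have hD := (H.continuousOn_deriv h0 h1 hm).comp hζ
    fun s hs => similarityVar_mem hy hs0 harr hs
  have hc : ContinuousOn (fun s => -(α / (2 + m)) * s ^ (-(α / (2 + m)) - 1) *
      W (-(y * s ^ (-(α / (2 + m))))) +
      s ^ (-(α / (2 + m))) * (profileDeriv α m z₀ W (-(y * s ^ (-(α / (2 + m))))) *
        (y * (α / (2 + m)) * s ^ (-(α / (2 + m)) - 1)))) (Ioi s₀) :=
    ((continuousOn_const.mul (hr _)).mul
      (H.cont.comp_continuousOn hζ)).add ((hr _).mul (hD.mul (continuousOn_const.mul (hr _))))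
  exact hc.congr fun s hs => if_pos hs

/-- Only the term with W' can be singular at s₀. Up to a bounded power of s it is the nonnegative
derivative of s ↦ W(-ys^(-B)), which is continuous on [s₀, T]; such a derivative is integrable. -/
lemma integrableOn_historyDeriv (H : ExtProfile α m z₀ W) (T : ℝ) :
    IntegrableOn (historyDeriv α m z₀ W y s₀) (Iic T) := by
  have hB0 := simExp_pos h0 hm
  have hleft : IntegrableOn (historyDeriv α m z₀ W y s₀) (Iic s₀) :=
    integrableOn_zero.congr_fun (fun s hs => (if_neg (not_lt.2 hs)).symm) measurableSet_Iic
  have hr : ∀ r : ℝ, ContinuousOn (fun s : ℝ => s ^ r) (Icc s₀ T) := fun r =>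
    continuousOn_id.rpow_const fun s hs => Or.inl (hs0.trans_le hs.1).ne'
  have hζ : ContinuousOn (fun s : ℝ => -(y * s ^ (-(α / (2 + m))))) (Icc s₀ T) :=
    (continuousOn_const.mul (hr _)).neg
  have hright : IntegrableOn (historyDeriv α m z₀ W y s₀) (Ioc s₀ T) := by
    have i1 : IntegrableOn (fun s => -(α / (2 + m)) * s ^ (-(α / (2 + m)) - 1) *
        W (-(y * s ^ (-(α / (2 + m)))))) (Ioc s₀ T) :=
      (((continuousOn_const.mul (hr _)).mul
        (H.cont.comp_continuousOn hζ)).integrableOn_Icc).mono_set Ioc_subset_Icc_self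
    have i2 : IntegrableOn (fun s => profileDeriv α m z₀ W (-(y * s ^ (-(α / (2 + m))))) *
        (y * (α / (2 + m)) * s ^ (-(α / (2 + m)) - 1))) (Ioc s₀ T) :=
      intervalIntegral.integrableOn_deriv_of_nonneg (H.cont.comp_continuousOn hζ)
        (fun s hs => (H.hasDerivAt h0 h1 hm (similarityVar_mem hy hs0 harr hs.1)).comp s
          (hasDerivAt_similarityVar (hs0.trans hs.1)))
        (fun s hs => mul_nonneg
          (H.deriv_nonneg h0 h1 hm (similarityVar_mem hy hs0 harr hs.1))
          (mul_nonneg (by positivity) (Real.rpow_nonneg (hs0.trans hs.1).le _)))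
    have i3 := Integrable.bdd_mul (c := s₀ ^ (-(α / (2 + m)))) i2
      (f := fun s => s ^ (-(α / (2 + m))))
      ((hr _).mono Ioc_subset_Icc_self |>.aestronglyMeasurable measurableSet_Ioc)
      (by
        filter_upwards [ae_restrict_mem measurableSet_Ioc] with s hs
        rw [Real.norm_of_nonneg (Real.rpow_nonneg (hs0.trans hs.1).le _)]
        exact Real.rpow_le_rpow_of_nonpos hs0 hs.1.le (by linarith))
    exact IntegrableOn.congr_fun (i1.add i3) (fun s hs => (if_pos hs.1).symm) measurableSet_Ioc
  exact (hleft.union hright).mono_set fun s hs =>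
    (le_or_gt s s₀).imp (fun h => h) fun h => ⟨h, hs⟩

lemma history_eq_integral (H : ExtProfile α m z₀ W) (s : ℝ) :
    history (α / (2 + m)) W y s = ∫ v in Iic s, historyDeriv α m z₀ W y s₀ v := by
  have hint := H.integrableOn_historyDeriv h0 h1 hm hy hs0 harr
  have hzero : ∫ v in Iic s₀, historyDeriv α m z₀ W y s₀ v = 0 :=
    setIntegral_eq_zero_of_forall_eq_zero fun v hv => if_neg (not_lt.2 hv)
  rcases le_or_gt s s₀ with h | h
  · rw [H.history_eq_zero harr h]
    exact (setIntegral_eq_zero_of_forall_eq_zero fun v hv =>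
      if_neg (not_lt.2 ((show v ≤ s from hv).trans h))).symm
  · have hco : ContinuousOn (history (α / (2 + m)) W y) (Icc s₀ s) := by
      have hr : ContinuousOn (fun s : ℝ => s ^ (-(α / (2 + m)))) (Icc s₀ s) :=
        continuousOn_id.rpow_const fun s hs => Or.inl (hs0.trans_le hs.1).ne'
      have hζ : ContinuousOn (fun s : ℝ => -(y * s ^ (-(α / (2 + m))))) (Icc s₀ s) :=
        (continuousOn_const.mul hr).neg
      exact (hr.mul (H.cont.comp_continuousOn hζ)).congr fun v hv => if_pos (hs0.trans_le hv.1)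
    have e := intervalIntegral.integral_eq_sub_of_hasDerivAt_of_le h.le hco
      (fun v hv => H.hasDerivAt_history h0 h1 hm hy hs0 harr hv.1)
      ((intervalIntegrable_iff_integrableOn_Ioc_of_le h.le).2
        ((hint s).mono_set Ioc_subset_Iic_self))
    rw [H.history_eq_zero harr le_rfl, sub_zero,
      ← intervalIntegral.integral_Iic_sub_Iic (hint _) (hint _), hzero, sub_zero] at e
    exact e.symm

end

/-- The Riemann–Liouville integral of the history is a rescaled dilation mean. -/
lemma integral_history {B y r : ℝ} (hr : 0 < r) :
    ∫ s in (0 : ℝ)..r, (r - s) ^ (-α) * history B W y s =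
      r ^ (1 - α - B) * dilationMean α B W (-(y * r ^ (-B))) := by
  have hsub := intervalIntegral.integral_comp_mul_left (a := 0) (b := 1)
    (fun s => (r - s) ^ (-α) * history B W y s) hr.ne'
  rw [mul_zero, mul_one, smul_eq_mul, eq_inv_mul_iff_mul_eq₀ hr.ne'] at hsub
  rw [← hsub, intervalIntegral.integral_of_le zero_le_one, integral_Ioc_eq_integral_Ioo,
    dilationMean, ← integral_const_mul, ← integral_const_mul]
  refine setIntegral_congr_fun measurableSet_Ioo fun σ hσ => ?_
  have e1 : (r - r * σ) ^ (-α) = r ^ (-α) * (1 - σ) ^ (-α) := by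
    rw [← Real.mul_rpow hr.le (by linarith [hσ.2])]; ring_nf
  have e2 : (r * σ) ^ (-B) = r ^ (-B) * σ ^ (-B) := Real.mul_rpow hr.le hσ.1.le
  have e3 : r ^ (1 - α - B) = r * r ^ (-α) * r ^ (-B) := by
    rw [show 1 - α - B = 1 + -α + -B by ring, Real.rpow_add hr, Real.rpow_add hr, Real.rpow_one]
  simp only [history, if_pos (mul_pos hr hσ.1), weight]
  rw [e1, e2, e3, show -(y * (r ^ (-B) * σ ^ (-B))) = -(y * r ^ (-B)) * σ ^ (-B) by ring]
  ring

end ExtProfile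

end FracPME

/-! ### Differentiability of the mean and the pointwise equation -/

namespace FracPME

namespace ExtProfile

variable {α m z₀ : ℝ} {W : ℝ → ℝ}

lemma hasDerivAt_integral_history (h0 : 0 < α) (h1 : α < 1) (hm : 0 < m)
    (H : ExtProfile α m z₀ W) {y s₀ t : ℝ} (hy : 0 < y) (hs0 : 0 < s₀)
    (harr : ∀ s, 0 < s → (s₀ < s ↔ y * s ^ (-(α / (2 + m))) < z₀)) (ht : s₀ < t) :
    HasDerivAt (fun r => ∫ s in (0 : ℝ)..r, (r - s) ^ (-α) * history (α / (2 + m)) W y s)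
      (∫ s in (0 : ℝ)..t, (t - s) ^ (-α) * historyDeriv α m z₀ W y s₀ s) t :=
  hasDerivAt_riemannLiouville h0 h1 hs0 ht (fun _ hs => if_neg (not_lt.2 hs))
    (H.continuousOn_historyDeriv h0 h1 hm hy hs0 harr)
    (H.integrableOn_historyDeriv h0 h1 hm hy hs0 harr)
    (H.history_eq_integral h0 h1 hm hy hs0 harr)

/-- Differentiating under the integral would meet the possible blow-up of W' at the front. Instead
`integral_history` is read backwards: fix the distance y = -z and express F near z through the
Riemann–Liouville integral, which is differentiable in time. -/
lemma differentiableAt_mean (h0 : 0 < α) (h1 : α < 1) (hm : 0 < m) (hz0 : 0 < z₀)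
    (H : ExtProfile α m z₀ W) {z : ℝ} (hz : z ∈ Ioo (-z₀) 0) :
    DifferentiableAt ℝ (dilationMean α (α / (2 + m)) W) z := by
  have hB0 := simExp_pos h0 hm
  set B := α / (2 + m) with hB
  have hy : 0 < -z := by linarith [hz.2]
  obtain ⟨s₀, hs0, harr⟩ := exists_arrival hB0 hz0 hy
  have ht : s₀ < 1 := (harr 1 one_pos).2 (by simpa using by linarith [hz.1])
  -- The time at which the similarity variable of the point at distance -z equals w; it is 1 for w =
  -- z.
  set T : ℝ → ℝ := fun w => (-w / -z) ^ (-B⁻¹) with hT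
  have hTz : T z = 1 := by simp [hT, div_self hz.2.ne]
  have hpos : ∀ w < 0, 0 < -w / -z := fun w hw => div_pos (by linarith) hy
  have hTd : DifferentiableAt ℝ T z :=
    (((differentiableAt_id (x := z)).neg.div_const (-z))).rpow_const (Or.inl (hpos z hz.2).ne')
  have hJ := (H.hasDerivAt_integral_history h0 h1 hm hy hs0 harr ht).differentiableAt
  rw [← hB, ← hTz] at hJ
  have hcomp := (hTd.rpow_const (p := -(1 - α - B)) (Or.inl (by rw [hTz]; exact one_ne_zero))).mul
    (hJ.comp z hTd)
  refine hcomp.congr_of_eventuallyEq ?_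
  filter_upwards [eventually_lt_nhds hz.2] with w hw
  have hTw : 0 < T w := Real.rpow_pos_of_pos (hpos w hw) _
  have e : -(-z * T w ^ (-B)) = w := by
    rw [hT]
    simp only
    rw [← Real.rpow_mul (hpos w hw).le, neg_mul_neg, inv_mul_cancel₀ hB0.ne', Real.rpow_one]
    field_simp [hz.2.ne]
  simp only [Pi.mul_apply, Function.comp]
  rw [integral_history hTw, e, ← mul_assoc, ← Real.rpow_add hTw, neg_add_cancel, Real.rpow_zero,
    one_mul]

/-- The Riemann–Liouville integral of the time derivative in terms of the dilation mean. -/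
lemma integral_historyDeriv (h0 : 0 < α) (h1 : α < 1) (hm : 0 < m) (hz0 : 0 < z₀)
    (H : ExtProfile α m z₀ W) {y s₀ t : ℝ} (hy : 0 < y) (hs0 : 0 < s₀)
    (harr : ∀ s, 0 < s → (s₀ < s ↔ y * s ^ (-(α / (2 + m))) < z₀)) (ht : s₀ < t) :
    ∫ s in (0 : ℝ)..t, (t - s) ^ (-α) * historyDeriv α m z₀ W y s₀ s =
      (1 - α - α / (2 + m)) * t ^ (1 - α - α / (2 + m) - 1) *
          dilationMean α (α / (2 + m)) W (-(y * t ^ (-(α / (2 + m))))) +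
        t ^ (1 - α - α / (2 + m)) *
          (deriv (dilationMean α (α / (2 + m)) W) (-(y * t ^ (-(α / (2 + m))))) *
            (y * (α / (2 + m)) * t ^ (-(α / (2 + m)) - 1))) := by
  have ht0 := hs0.trans ht
  have hF := (H.differentiableAt_mean h0 h1 hm hz0
    (similarityVar_mem hy hs0 harr ht)).hasDerivAt
  have d := (Real.hasDerivAt_rpow_const (x := t) (p := 1 - α - α / (2 + m))
    (Or.inl ht0.ne')).mul (hF.comp t (hasDerivAt_similarityVar (y := y) ht0))
  -- The same function of time is differentiated twice, as a Riemann–Liouville integral and as a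
  -- rescaled mean.
  refine (H.hasDerivAt_integral_history h0 h1 hm hy hs0 harr ht).unique
    (d.congr_of_eventuallyEq ?_)
  filter_upwards [eventually_gt_nhds ht0] with r hr
  exact integral_history hr

lemma hasDerivAt_flux (h0 : 0 < α) (h1 : α < 1) (hm : 0 < m) (hz0 : 0 < z₀)
    (H : ExtProfile α m z₀ W) {z : ℝ} (hz : z ∈ Ioo (-z₀) 0) :
    HasDerivAt (profileFlux α (α / (2 + m)) z₀ W)
      ((1 - α - α / (2 + m)) * dilationMean α (α / (2 + m)) W z -
        α / (2 + m) * z * deriv (dilationMean α (α / (2 + m)) W) z) z := by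
  have hF := (H.differentiableAt_mean h0 h1 hm hz0 hz).hasDerivAt
  have d := ((H.hasDerivAt_integral_mean h0 h1 hm z).const_mul (1 - α)).sub
    (((hasDerivAt_id z).const_mul (α / (2 + m))).mul hF)
  refine d.congr_deriv ?_
  simp only [id]
  ring

/-- The self-similar function is a strong solution inside its support, away from the origin. -/
lemma isStrongSolutionAt (h0 : 0 < α) (h1 : α < 1) (hm : 0 < m) (hz0 : 0 < z₀)
    (H : ExtProfile α m z₀ W) {x t : ℝ} (hx : x ≠ 0) (ht : 0 < t)
    (hxt : |x| * t ^ (-(α / (2 + m))) < z₀) :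
    IsStrongSolutionAt α m (fun x t => history (α / (2 + m)) W |x| t) x t := by
  have hB0 := simExp_pos h0 hm
  have hG := Real.Gamma_pos_of_pos (show 0 < 1 - α by linarith)
  have hy : 0 < |x| := abs_pos.2 hx
  obtain ⟨s₀, hs0, harr⟩ := exists_arrival hB0 hz0 hy
  have hst : s₀ < t := (harr t ht).2 hxt
  have hp0 : ∀ s ≤ s₀, historyDeriv α m z₀ W |x| s₀ s = 0 := fun s hs => if_neg (not_lt.2 hs)
  have hpi := H.integrableOn_historyDeriv h0 h1 hm hy hs0 harr
  have hpc := H.continuousOn_historyDeriv h0 h1 hm hy hs0 harr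
  have hhd : ∀ s, s ≠ s₀ → deriv (history (α / (2 + m)) W |x|) s =
      historyDeriv α m z₀ W |x| s₀ s := by
    intro s hs
    rcases hs.lt_or_gt with h | h
    · have : history (α / (2 + m)) W |x| =ᶠ[𝓝 s] fun _ => 0 := by
        filter_upwards [eventually_lt_nhds h] with r hr
        exact H.history_eq_zero harr hr.le
      rw [this.deriv_eq, deriv_const, hp0 s h.le]
    · exact (H.hasDerivAt_history h0 h1 hm hy hs0 harr h).deriv
  -- The history may fail to be differentiable at the arrival time; a single instant does not affect
  -- the integral.
  have hae : ∀ᵐ s : ℝ, (t - s) ^ (-α) * historyDeriv α m z₀ W |x| s₀ s =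
      (t - s) ^ (-α) * deriv (history (α / (2 + m)) W |x|) s := by
    filter_upwards [Measure.ae_ne volume s₀] with s hs
    rw [hhd s hs]
  have hcap : caputo α (history (α / (2 + m)) W |x|) t = 1 / Real.Gamma (1 - α) *
      ∫ s in (0 : ℝ)..t, (t - s) ^ (-α) * historyDeriv α m z₀ W |x| s₀ s := by
    rw [caputo]
    congr 1
    exact intervalIntegral.integral_congr_ae (hae.mono fun s hs _ => hs.symm)
  -- ε is the sign of x; near x, |y| = εy is linear, and ε drops out of the second-order expression
  -- as ε² = 1.
  obtain ⟨ε, hε2, hεx⟩ : ∃ ε : ℝ, ε * ε = 1 ∧ 0 < ε * x := by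
    rcases hx.lt_or_gt with h | h
    · exact ⟨-1, by norm_num, by linarith⟩
    · exact ⟨1, by norm_num, by linarith⟩
  have hε1 : |ε| = 1 := by
    have : |ε| * |ε| = 1 := by rw [← abs_mul, hε2, abs_one]
    nlinarith [abs_nonneg ε]
  have habs : ∀ y, 0 < ε * y → |y| = ε * y := fun y h => by
    rw [← abs_of_pos h, abs_mul, hε1, one_mul]
  set b := t ^ (-(α / (2 + m))) with hb
  have hb0 : 0 < b := Real.rpow_pos_of_pos ht _
  set ζ : ℝ → ℝ := fun y => -(ε * y * b) with hζ
  have hζd : ∀ y, HasDerivAt ζ (-(ε * b)) y := fun y =>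
    ((((hasDerivAt_id y).const_mul ε).mul_const b).neg).congr_deriv (by ring)
  have hζc : Continuous ζ := by fun_prop
  have hopen : IsOpen {y | 0 < ε * y ∧ ζ y ∈ Ioo (-z₀) 0} :=
    (isOpen_lt continuous_const (continuous_const.mul continuous_id)).inter
      (isOpen_Ioo.preimage hζc)
  have hmem : x ∈ {y | 0 < ε * y ∧ ζ y ∈ Ioo (-z₀) 0} := by
    rw [habs x hεx] at hxt
    refine ⟨hεx, ?_, ?_⟩
    · simp only [hζ]; linarith
    · simp only [hζ]; linarith [mul_pos hεx hb0]
  have hO := hopen.mem_nhds hmem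
  have hu : ∀ y, 0 < ε * y → history (α / (2 + m)) W |y| t = b * W (ζ y) := fun y hy => by
    rw [history, if_pos ht, habs y hy]
  have hud : ∀ y ∈ {y | 0 < ε * y ∧ ζ y ∈ Ioo (-z₀) 0},
      HasDerivAt (fun y' => history (α / (2 + m)) W |y'| t)
        (b * (profileDeriv α m z₀ W (ζ y) * -(ε * b))) y := by
    intro y hy
    have d := ((H.hasDerivAt h0 h1 hm hy.2).comp y (hζd y)).const_mul b
    refine d.congr_of_eventuallyEq ?_
    filter_upwards [hopen.mem_nhds hy] with y' hy'
    exact hu y' hy'.1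
  have hder : (fun y => deriv (fun y' => history (α / (2 + m)) W |y'| t) y) =ᶠ[𝓝 x]
      fun y => b * (profileDeriv α m z₀ W (ζ y) * -(ε * b)) := by
    filter_upwards [hO] with y hy
    exact (hud y hy).deriv
  have hflux := H.hasDerivAt_flux h0 h1 hm hz0 hmem.2
  refine ⟨?_, ?_, ?_, ?_, ?_, ?_⟩
  · exact (H.hasDerivAt_history h0 h1 hm hy hs0 harr hst).differentiableAt
  · have hi : IntervalIntegrable (historyDeriv α m z₀ W |x| s₀) volume 0 t :=
      (intervalIntegrable_iff_integrableOn_Ioc_of_le ht.le).2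
        ((hpi t).mono_set Ioc_subset_Iic_self)
    have e : (fun s => history (α / (2 + m)) W |x| s) =
        fun s => ∫ v in (0 : ℝ)..s, historyDeriv α m z₀ W |x| s₀ v := by
      ext s
      rw [H.history_eq_integral h0 h1 hm hy hs0 harr s,
        ← intervalIntegral.integral_Iic_sub_Iic (hpi 0) (hpi s),
        ← H.history_eq_integral h0 h1 hm hy hs0 harr 0, history, if_neg (lt_irrefl _), sub_zero]
    rw [e]
    exact hi.absolutelyContinuousOnInterval_intervalIntegral left_mem_uIcc
  · exact (intervalIntegrable_riemannLiouville h0 h1 hs0 hst hp0 hpc hpi).congr_ae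
      (ae_restrict_of_ae hae)
  · filter_upwards [hO] with y hy
    exact (hud y hy).differentiableAt
  · refine DifferentiableAt.congr_of_eventuallyEq ?_ hder
    have hD : DifferentiableAt ℝ (profileDeriv α m z₀ W) (ζ x) :=
      ((H.hasDerivAt h0 h1 hm hmem.2).differentiableAt.rpow_const
        (Or.inl (H.pos _ hmem.2.1).ne')).mul (hflux.differentiableAt.div_const _)
    exact ((hD.comp x (hζd x).differentiableAt).mul_const _).const_mul _
  · have hEq : (fun y => (history (α / (2 + m)) W |y| t) ^ m *
        deriv (fun y' => history (α / (2 + m)) W |y'| t) y) =ᶠ[𝓝 x] fun y =>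
          -(ε * (b ^ m * b * b) / Real.Gamma (1 - α)) *
            profileFlux α (α / (2 + m)) z₀ W (ζ y) := by
      filter_upwards [hO, hder] with y hy hdy
      have hW := H.pos _ hy.2.1
      rw [hdy, hu y hy.1, Real.mul_rpow hb0.le hW.le, profileDeriv, Real.rpow_neg hW.le]
      have := (Real.rpow_pos_of_pos hW m).ne'
      field_simp
    have d := (hflux.comp x (hζd x)).const_mul (-(ε * (b ^ m * b * b) / Real.Gamma (1 - α)))
    refine (d.congr_of_eventuallyEq hEq).congr_deriv ?_
    have hζx : -(|x| * b) = ζ x := by rw [habs x hεx]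
    -- The similarity exponent balances both sides here: α = (2+m)B gives -α - B = -(m+3)B.
    have e1 : t ^ (1 - α - α / (2 + m) - 1) = b ^ m * b * b * b := by
      rw [hb, ← Real.rpow_mul ht.le, ← Real.rpow_add ht, ← Real.rpow_add ht, ← Real.rpow_add ht]
      congr 1; field_simp; ring
    have e2 : t ^ (1 - α - α / (2 + m)) * t ^ (-(α / (2 + m)) - 1) =
        b * t ^ (1 - α - α / (2 + m) - 1) := by
      rw [hb, ← Real.rpow_add ht, ← Real.rpow_add ht]
      congr 1; ring
    rw [show (fun s => history (α / (2 + m)) W |x| s) = history (α / (2 + m)) W |x| from rfl,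
      hcap, H.integral_historyDeriv h0 h1 hm hz0 hy hs0 harr hst, ← hb, hζx]
    have hbx : |x| * b = -ζ x := by linarith
    calc _ = (ε * ε) * (b ^ m * b * b * b) / Real.Gamma (1 - α) *
          ((1 - α - α / (2 + m)) * dilationMean α (α / (2 + m)) W (ζ x) -
            α / (2 + m) * ζ x * deriv (dilationMean α (α / (2 + m)) W) (ζ x)) := by ring
      _ = 1 / Real.Gamma (1 - α) * ((1 - α - α / (2 + m)) * (b ^ m * b * b * b) *
          dilationMean α (α / (2 + m)) W (ζ x) + (|x| * b) * (α / (2 + m)) *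
            deriv (dilationMean α (α / (2 + m)) W) (ζ x) * (b ^ m * b * b * b)) := by
          rw [hbx, hε2]; ring
      _ = 1 / Real.Gamma (1 - α) * ((1 - α - α / (2 + m)) * t ^ (1 - α - α / (2 + m) - 1) *
          dilationMean α (α / (2 + m)) W (ζ x) + |x| * (α / (2 + m)) *
            deriv (dilationMean α (α / (2 + m)) W) (ζ x) *
              (b * t ^ (1 - α - α / (2 + m) - 1))) := by rw [e1]; ring
      _ = _ := by rw [← e2]; ring

end ExtProfile

/-- The cutoff at the front is already contained in W, which vanishes to the left of -z₀. -/
lemma barenblatt_eq_history {α m z₀ : ℝ} {U W : ℝ → ℝ} (H : ExtProfile α m z₀ W)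
    (hWU : ∀ z ∈ Icc (-z₀) 0, W z = U z) (x t : ℝ) :
    barenblatt α m z₀ U x t = history (α / (2 + m)) W |x| t := by
  unfold barenblatt history simExp
  by_cases ht : 0 < t
  · have hiff : |x| ≤ z₀ * t ^ (α / (2 + m)) ↔ |x| * t ^ (-(α / (2 + m))) ≤ z₀ := by
      rw [Real.rpow_neg ht.le, ← div_eq_mul_inv, div_le_iff₀ (Real.rpow_pos_of_pos ht _)]
    have hnn : 0 ≤ |x| * t ^ (-(α / (2 + m))) :=
      mul_nonneg (abs_nonneg x) (Real.rpow_nonneg ht.le _)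
    rw [if_pos ht]
    split_ifs with h
    · rw [hWU _ ⟨by linarith [hiff.1 h.2], by linarith⟩]
    · rw [H.zero _ (by linarith [not_le.1 fun h' => h ⟨ht, hiff.2 h'⟩]), mul_zero]
  · rw [if_neg ht, if_neg fun h => ht h.1]

/-! ### Mass -/

lemma integrable_evenProfile {z₀ : ℝ} {U W : ℝ → ℝ} (hz0 : 0 < z₀) (hW : Continuous W)
    (hWU : ∀ z ∈ Icc (-z₀) 0, W z = U z) :
    Integrable (evenProfile z₀ U) ∧
      ∫ z, evenProfile z₀ U z = 2 * ∫ z in (-z₀)..0, U z := by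
  have e : evenProfile z₀ U = indicator (Icc (-z₀) z₀) fun z => W (-|z|) := by
    ext z
    by_cases hz : |z| ≤ z₀
    · rw [indicator_of_mem (mem_Icc.2 (abs_le.1 hz)), evenProfile, if_pos hz,
        hWU _ ⟨by linarith, by linarith [abs_nonneg z]⟩]
    · rw [indicator_of_notMem fun h => hz (abs_le.2 (mem_Icc.1 h)), evenProfile, if_neg hz]
  have hc : Continuous fun z => W (-|z|) := hW.comp continuous_abs.neg
  rw [e]
  refine ⟨(integrable_indicator_iff measurableSet_Icc).2 hc.integrableOn_Icc, ?_⟩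
  rw [integral_indicator measurableSet_Icc, integral_Icc_eq_integral_Ioc,
    ← intervalIntegral.integral_of_le (by linarith),
    ← intervalIntegral.integral_add_adjacent_intervals (hc.intervalIntegrable (-z₀) 0)
      (hc.intervalIntegrable 0 z₀)]
  have e1 : ∫ z in (-z₀)..0, W (-|z|) = ∫ z in (-z₀)..0, U z := by
    refine intervalIntegral.integral_congr fun z hz => ?_
    rw [uIcc_of_le (by linarith)] at hz
    rw [abs_of_nonpos hz.2, neg_neg, hWU z hz]
  have e2 : ∫ z in (0 : ℝ)..z₀, W (-|z|) = ∫ z in (-z₀)..0, W (-|z|) := by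
    have := intervalIntegral.integral_comp_neg (a := 0) (b := z₀) fun z => W (-|z|)
    simpa only [abs_neg, neg_zero] using this
  rw [e2, e1]; ring

lemma barenblatt_eq_evenProfile {α m z₀ t : ℝ} (ht : 0 < t) (U : ℝ → ℝ) (x : ℝ) :
    barenblatt α m z₀ U x t =
      t ^ (-simExp α m) * evenProfile z₀ U (x * t ^ (-simExp α m)) := by
  have hb : 0 < t ^ (-simExp α m) := Real.rpow_pos_of_pos ht _
  have hiff : |x| ≤ z₀ * t ^ simExp α m ↔ |x * t ^ (-simExp α m)| ≤ z₀ := by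
    rw [abs_mul, abs_of_pos hb, Real.rpow_neg ht.le, ← div_eq_mul_inv,
      div_le_iff₀ (Real.rpow_pos_of_pos ht _)]
  unfold barenblatt evenProfile
  by_cases h : |x| ≤ z₀ * t ^ simExp α m
  · rw [if_pos ⟨ht, h⟩, if_pos (hiff.1 h), abs_mul, abs_of_pos hb]
  · rw [if_neg fun h' => h h'.2, if_neg fun h' => h (hiff.2 h'), mul_zero]

lemma integral_barenblatt {α m z₀ t : ℝ} (ht : 0 < t) {U : ℝ → ℝ}
    (hU : Integrable (evenProfile z₀ U)) :
    Integrable (fun x => barenblatt α m z₀ U x t) ∧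
      ∫ x, barenblatt α m z₀ U x t = ∫ z, evenProfile z₀ U z := by
  have hb : 0 < t ^ (-simExp α m) := Real.rpow_pos_of_pos ht _
  simp only [barenblatt_eq_evenProfile ht]
  refine ⟨(hU.comp_mul_right' hb.ne').const_mul _, ?_⟩
  rw [integral_const_mul, Measure.integral_comp_mul_right, abs_of_pos (inv_pos.2 hb), smul_eq_mul,
    mul_inv_cancel_left₀ hb.ne']

end FracPME

theorem mainTheorem3 (α m : ℝ) (hα0 : 0 < α) (hα1 : α < 1) (hm : 0 < m)
    (U : ℝ → ℝ → ℝ)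
    (hU : ∀ z₀ : ℝ, 0 < z₀ → FracPME.IsNontrivialProfile α m z₀ (U z₀)) :
    (∃! zs : ℝ, 0 < zs ∧ ∫ z in (-zs)..0, U zs z = 1 / 2) ∧
    ∀ zs : ℝ, 0 < zs → (∫ z in (-zs)..0, U zs z = 1 / 2) →
      ∀ t₀ : ℝ, 0 < t₀ →
        (∀ z₁ z₂ : ℝ, 0 < z₁ → z₁ < z₂ → z₂ < zs →
          ∀ x t : ℝ, t₀ ≤ t →
            z₁ ≤ |x| * t ^ (-(α / (2 + m))) → |x| * t ^ (-(α / (2 + m))) ≤ z₂ →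
            FracPME.IsStrongSolutionAt α m (FracPME.barenblatt α m zs (U zs)) x t) ∧
        (Integrable (FracPME.evenProfile zs (U zs)) ∧
          ∫ z, FracPME.evenProfile zs (U zs) z = 1) ∧
        (∀ t : ℝ, t₀ ≤ t →
          Integrable (fun x => FracPME.barenblatt α m zs (U zs) x t) ∧
          ∫ x, FracPME.barenblatt α m zs (U zs) x t = 1) := by
  refine ⟨FracPME.existsUnique_halfWidth hα0 hα1 hm hU, fun zs hzs hmass t₀ ht₀ => ?_⟩
  obtain ⟨W, H, hWU⟩ := (hU zs hzs).exists_extProfile hα0 hα1 hm hzs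
  have hev := FracPME.integrable_evenProfile hzs H.cont hWU
  have hone : ∫ z, FracPME.evenProfile zs (U zs) z = 1 := by rw [hev.2, hmass]; norm_num
  refine ⟨fun z₁ z₂ hz1 _ hz2 x t ht hx1 hx2 => ?_, ⟨hev.1, hone⟩, fun t ht => ?_⟩
  · have e : FracPME.barenblatt α m zs (U zs) =
        fun x t => FracPME.history (α / (2 + m)) W |x| t :=
      funext₂ fun x t => FracPME.barenblatt_eq_history H hWU x t
    -- The lower bound z₁ > 0 excludes the origin, where |x| is not differentiable.
    have hx : x ≠ 0 := by
      rintro rfl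
      rw [abs_zero, zero_mul] at hx1
      linarith
    rw [e]
    exact H.isStrongSolutionAt hα0 hα1 hm hzs hx (ht₀.trans_le ht) (hx2.trans_lt hz2)
  · have h := FracPME.integral_barenblatt (α := α) (m := m) (ht₀.trans_le ht) hev.1
    exact ⟨h.1, h.2.trans hone⟩
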